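/- **Setting.** Let $D\ge 0$, $T\ge 1$ and $N\ge 1$ be integers, $\mathsf X=\mathbb R^D$, $[N]_0=\{0,\dots,N\}$, $\kappa\in\{0,1\}$ and $\delta_1,\dots,\delta_T>0$. Let $Q_1:\mathsf X\to(0,\infty)$ and $Q_t:\mathsf X\times\mathsf X\to(0,\infty)$, $2\le t\le T$, be differentiable (write $Q_1(x_{0:1})=Q_1(x_1)$), and assume that $\prod_{t=1}^T Q_t(x_{t-1:t})$ is Lebesgue integrable on $\mathsf X^T$. Let $\pi_T$ be the probability distribution on $\mathsf X^T$ with density proportional to $\prod_{t=1}^T Q_t(x_{t-1:t})$. Put $\phi_t(x_{t-1:t})=\kappa\frac{\delta_t}{2}\nabla_{x_t}\log Q_t(x_{t-1:t})$; the gradient is the filter gradient $\nabla_{x_t}\log\pi_t(x_{1:t})$ of $\pi_t(x_{1:t})\propto\prod_{s=1}^tQ_s(x_{s-1:s})$. With $\mathrm N(\cdot\,;m,\Sigma)$ the Gaussian density, let $$G'_t(x_{t-1:t};u_t)=Q_t(x_{t-1:t})\,\frac{\mathrm N(u_t;x_t+\phi_t(x_{t-1:t}),\frac{\delta_t}2\mathbf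 I)}{\mathrm N(u_t;x_t,\frac{\delta_t}2\mathbf I)},\qquad Q'_t(x_{t-1:t};u_t)=\mathrm N(x_t;u_t,\tfrac{\delta_t}2\mathbf I)\,G'_t(x_{t-1:t};u_t).$$ **Particle-aMALA.** Given $x_{1:T}\in\mathsf X^T$: 1. For $t=1,\dots,T$: (a) sample $k_t$ uniformly from $[N]_0$ and set $x_t^{k_t}=x_t$; (b) if $t>1$, set $a_{t-1}^{k_t}=k_{t-1}$ and, independently for $n\ne k_t$, sample $a_{t-1}^n=i$ with probability $W_{t-1}^i$; (c) sample $u_t\sim\mathrm N(x_t+\phi_t(x_{t-1:t}),\frac{\delta_t}2\mathbf I)$ and, conditionally independently for $n\neq k_t$, $x_t^n\sim\mathrm N(u_t,\frac{\delta_t}2\mathbf I)$; (d) for $n\in[N]_0$ set $w_t^n=G'_t(x_{t-1}^{a_{t-1}^n},x_t^n;u_t)$ and $W_t^n=w_t^n/\sum_{m=0}^Nw_t^m$. 2. Sample $i\in[N]_0\setminus\{k_T\}$ with probability $W_T^i/(1-W_T^{k_T})$; set $l_T=i$ with probability $1\wedge\frac{1-W_T^{k_T}}{1-W_T^i}$,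 otherwise $l_T=k_T$. 3. For $t=T-1,\dots,1$ sample $l_t=i\in[N]_0$ with probability $\dfrac{W_t^iQ'_{t+1}(x_t^i,x_{t+1}^{l_{t+1}};u_{t+1})}{\sum_{n=0}^NW_t^nQ'_{t+1}(x_t^n,x_{t+1}^{l_{t+1}};u_{t+1})}$. 4. Return $\tilde x_{1:T}=(x_1^{l_1},\dots,x_T^{l_T})$. **Proposition.** Sampling $\tilde x_{1:T}$ given $x_{1:T}$ by this algorithm induces a Markov kernel $P(\tilde x_{1:T}\mid x_{1:T})$ on $\mathsf X^T$, and $P$ leaves $\pi_T$ invariant, that is, $\int P(\cdot\mid x_{1:T})\,\pi_T(\mathrm dx_{1:T})=\pi_T$. -/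

import Mathlib

open MeasureTheory ProbabilityTheory

namespace ParticleAMALA

/-- The state space `ℝ^D`. -/
abbrev X (D : ℕ) : Type := EuclideanSpace ℝ (Fin D)

/-! ### The target -/

/-- The unnormalised density `Q₁(x₁) ∏ Q_t(x_{t-1}, x_t)` of a model with `r + 1` time points.
Coordinates are numbered `0, …, r`; `Q i` is the factor that links coordinates `i` and `i + 1`. -/
noncomputable def unnormDensity {D r : ℕ} (Q₁ : X D → ℝ) (Q : Fin r → X D → X D → ℝ)
    (x : Fin (r + 1) → X D) : ℝ :=
  Q₁ (x 0) * ∏ i : Fin r, Q i (x i.castSucc) (x i.succ)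

/-- The normalised density. With the factors of all time points this is the joint smoothing
density `π_T`; with the factors of the first `t` time points it is the filter `π_t`. -/
noncomputable def density {D r : ℕ} (Q₁ : X D → ℝ) (Q : Fin r → X D → X D → ℝ)
    (x : Fin (r + 1) → X D) : ℝ :=
  unnormDensity Q₁ Q x / ∫ y, unnormDensity Q₁ Q y

/-- The joint smoothing distribution on `X^(r+1)`. -/
noncomputable def smoothing {D r : ℕ} (Q₁ : X D → ℝ) (Q : Fin r → X D → X D → ℝ) :
    Measure (Fin (r + 1) → X D) :=
  (volume : Measure (Fin (r + 1) → X D)).withDensity fun x => ENNReal.ofReal (density Q₁ Q x)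

/-! ### Gaussian distributions with covariance `v I` -/

/-- The density `N(x; m, v I)`. -/
noncomputable def gaussianDensity {D : ℕ} (m : X D) (v : ℝ) (x : X D) : ℝ :=
  ((Real.sqrt (2 * Real.pi * v)) ^ D)⁻¹ * Real.exp (-‖x - m‖ ^ 2 / (2 * v))

/-- The distribution `N(m, v I)`. -/
noncomputable def gaussian {D : ℕ} (m : X D) (v : ℝ) : Measure (X D) :=
  (volume : Measure (X D)).withDensity fun x => ENNReal.ofReal (gaussianDensity m v x)

/-! ### Proposal, potential and weights

Below `q` stands for the factor of the current time point as a function of the current state: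
`q = Q₁` at the first time point, and `q = Q_t(x_{t-1}, ·)` afterwards. -/

/-- `x_t + κ (δ_t / 2) ∇_{x_t} log Q_t(x_{t-1}, x_t)`. The gradient is the filter gradient
`∇_{x_t} log π_t(x_{1:t})`, see `gradient_log_filter_zero` and `gradient_log_filter_succ`. -/
noncomputable def drift {D : ℕ} (κ δ : ℝ) (q : X D → ℝ) (x : X D) : X D :=
  x + (κ * (δ / 2)) • gradient (fun y => Real.log (q y)) x

/-- The potential `G'_t(x_{t-1}, x_t; u_t)`. -/
noncomputable def potential {D : ℕ} (κ δ : ℝ) (q : X D → ℝ) (u x : X D) : ℝ :=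
  q x * (gaussianDensity (drift κ δ q x) (δ / 2) u / gaussianDensity x (δ / 2) u)

/-- `Q'_t(x_{t-1}, x_t; u_t) = N(x_t; u_t, (δ_t / 2) I) G'_t(x_{t-1}, x_t; u_t)`. -/
noncomputable def modifiedFactor {D : ℕ} (κ δ : ℝ) (q : X D → ℝ) (u x : X D) : ℝ :=
  gaussianDensity u (δ / 2) x * potential κ δ q u x

/-- Normalisation `W^n = w^n / ∑ m, w^m`. -/
noncomputable def normalize {N : ℕ} (w : Fin (N + 1) → ℝ) : Fin (N + 1) → ℝ :=
  fun n => w n / ∑ m, w m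

/-! ### The elementary sampling steps -/

/-- The law on a finite set that gives the point `i` the probability `p i`. -/
noncomputable def discrete {N : ℕ} (p : Fin (N + 1) → ℝ) : Measure (Fin (N + 1)) :=
  ∑ i, ENNReal.ofReal (p i) • Measure.dirac i

/-- The law of `k_t`, uniform on the `N + 1` indices. -/
noncomputable def uniformIndex (N : ℕ) : Measure (Fin (N + 1)) :=
  discrete fun _ => 1 / ((N : ℝ) + 1)

/-- The ancestor indices: the one of particle `k'` is `k`, the other ones are drawn independently
with the probabilities `W`. -/
noncomputable def ancestors {N : ℕ} (W : Fin (N + 1) → ℝ) (k k' : Fin (N + 1)) :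
    Measure (Fin (N + 1) → Fin (N + 1)) :=
  Measure.pi fun n => if n = k' then Measure.dirac k else discrete W

/-- The particles: the one with index `k` is the reference state `x`, the other ones are drawn
independently from `N(u, (δ / 2) I)`. -/
noncomputable def particles {D N : ℕ} (δ : ℝ) (u x : X D) (k : Fin (N + 1)) :
    Measure (Fin (N + 1) → X D) :=
  Measure.pi fun n => if n = k then Measure.dirac x else gaussian u (δ / 2)

/-- The forced-move step at the final time point: draw `i ≠ k` with probability
`W i / (1 - W k)`, return `i` with probability `min 1 ((1 - W k) / (1 - W i))` and `k`
otherwise. -/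
noncomputable def forcedMove {N : ℕ} (W : Fin (N + 1) → ℝ) (k : Fin (N + 1)) :
    Measure (Fin (N + 1)) :=
  (discrete fun i => if i = k then 0 else W i / (1 - W k)).bind fun i =>
    ENNReal.ofReal (min 1 ((1 - W k) / (1 - W i))) • Measure.dirac i +
      ENNReal.ofReal (1 - min 1 ((1 - W k) / (1 - W i))) • Measure.dirac k

/-- The backward-sampling step: draw `i` with probability proportional to
`W_t^i Q'_{t+1}(z^i, y; u_{t+1})`, where `y` is the state already selected at time `t + 1`. -/
noncomputable def backward {D N : ℕ} (κ δ : ℝ) (q : X D → X D → ℝ) (u : X D)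
    (W : Fin (N + 1) → ℝ) (z : Fin (N + 1) → X D) (y : X D) : Measure (Fin (N + 1)) :=
  discrete (normalize fun i => W i * modifiedFactor κ δ (q (z i)) u y)

/-! ### The algorithm -/

/-- The rest of the algorithm from some time point `t` on, when `r` further time points follow.
`δ` and `Q` are the step sizes and factors of those `r` time points, `x` is the reference path at
time `t` and later, `k`, `z` and `W` are the index of the reference particle, the particles and
the normalised weights at time `t`. The result is the law of the new path at time `t` and later.

If `t` is the final time point, only the forced move remains. Otherwise the forward step to time
`t + 1` is made (new reference index `k'`, ancestors `a`, auxiliary variable `u`, particles `z'`,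
normalised weights), then the rest of the algorithm from time `t + 1` on, and then the
backward-sampling step at time `t`. -/
noncomputable def continueFrom {D N : ℕ} (κ : ℝ) : (r : ℕ) → (δ : Fin r → ℝ) →
    (Q : Fin r → X D → X D → ℝ) → (x : Fin (r + 1) → X D) → (k : Fin (N + 1)) →
    (z : Fin (N + 1) → X D) → (W : Fin (N + 1) → ℝ) → Measure (Fin (r + 1) → X D)
  | 0, _, _, _, k, z, W =>
      (forcedMove W k).bind fun l => Measure.dirac fun _ => z l
  | r + 1, δ, Q, x, k, z, W =>
      (uniformIndex N).bind fun k' =>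
      (ancestors W k k').bind fun a =>
      (gaussian (drift κ (δ 0) (Q 0 (x 0)) (x 1)) (δ 0 / 2)).bind fun u =>
      (particles (δ 0) u (x 1) k').bind fun z' =>
      (continueFrom κ r (Fin.tail δ) (Fin.tail Q) (Fin.tail x) k' z'
        (normalize fun n => potential κ (δ 0) (Q 0 (z (a n))) u (z' n))).bind fun y =>
      (backward κ (δ 0) (Q 0) u W z (y 0)).bind fun l =>
      Measure.dirac (Fin.cons (z l) y)

/-- The law of the new path produced by one iteration of the Particle-aMALA algorithm with `N`
proposals per time point, started at the reference path `x`. -/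
noncomputable def step {D r : ℕ} (N : ℕ) (κ : ℝ) (δ : Fin (r + 1) → ℝ) (Q₁ : X D → ℝ)
    (Q : Fin r → X D → X D → ℝ) (x : Fin (r + 1) → X D) : Measure (Fin (r + 1) → X D) :=
  (uniformIndex N).bind fun k =>
  (gaussian (drift κ (δ 0) Q₁ (x 0)) (δ 0 / 2)).bind fun u =>
  (particles (δ 0) u (x 0) k).bind fun z =>
  continueFrom κ r (Fin.tail δ) Q x k z (normalize fun n => potential κ (δ 0) Q₁ u (z n))

/-! ### The gradient in `drift` is the gradient of the logarithm of the filter density -/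

theorem unnormDensity_pos {D r : ℕ} {Q₁ : X D → ℝ} {Q : Fin r → X D → X D → ℝ}
    (hQ₁ : ∀ x, 0 < Q₁ x) (hQ : ∀ i x y, 0 < Q i x y) (x : Fin (r + 1) → X D) :
    0 < unnormDensity Q₁ Q x :=
  mul_pos (hQ₁ _) (Finset.prod_pos fun i _ => hQ i _ _)

theorem integral_unnormDensity_pos {D r : ℕ} {Q₁ : X D → ℝ} {Q : Fin r → X D → X D → ℝ}
    (hQ₁ : ∀ x, 0 < Q₁ x) (hQ : ∀ i x y, 0 < Q i x y)
    (hint : Integrable (unnormDensity Q₁ Q)) : 0 < ∫ y, unnormDensity Q₁ Q y := by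
  rw [integral_pos_iff_support_of_nonneg (fun x => (unnormDensity_pos hQ₁ hQ x).le) hint]
  have h : Function.support (unnormDensity Q₁ Q) = Set.univ := by
    ext x
    simpa using (unnormDensity_pos hQ₁ hQ x).ne'
  rw [h]
  exact isOpen_univ.measure_pos _ Set.univ_nonempty

/-- Constant positive factors do not change the gradient of the logarithm. -/
theorem gradient_log_const_mul {D : ℕ} {c : ℝ} (hc : 0 < c) {q : X D → ℝ} (hq : ∀ y, 0 < q y)
    (y : X D) :
    gradient (fun y => Real.log (c * q y)) y = gradient (fun y => Real.log (q y)) y := by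
  have h : (fun y => Real.log (c * q y)) = fun y => Real.log c + Real.log (q y) := by
    funext y
    exact Real.log_mul hc.ne' (hq y).ne'
  rw [h]
  simp only [gradient, fderiv_const_add]

/-- `∇_{x₁} log π₁(x₁) = ∇_{x₁} log Q₁(x₁)`. -/
theorem gradient_log_filter_zero {D : ℕ} {Q₁ : X D → ℝ} {Q : Fin 0 → X D → X D → ℝ}
    (hQ₁ : ∀ x, 0 < Q₁ x) (hint : Integrable (unnormDensity Q₁ Q)) (y : X D) :
    gradient (fun y => Real.log (density Q₁ Q fun _ => y)) y =
      gradient (fun y => Real.log (Q₁ y)) y := by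
  have hZ := integral_unnormDensity_pos hQ₁ (fun i => i.elim0) hint
  rw [← gradient_log_const_mul (inv_pos.mpr hZ) hQ₁ y]
  congr 1
  funext y
  simp [density, unnormDensity, div_eq_inv_mul]

/-- `∇_{x_t} log π_t(x_{1:t}) = ∇_{x_t} log Q_t(x_{t-1}, x_t)` for `t = r + 2`; here `x` is the
path up to time `t - 1` and `y` is the state at time `t`. -/
theorem gradient_log_filter_succ {D r : ℕ} {Q₁ : X D → ℝ} {Q : Fin (r + 1) → X D → X D → ℝ}
    (hQ₁ : ∀ x, 0 < Q₁ x) (hQ : ∀ i x y, 0 < Q i x y)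
    (hint : Integrable (unnormDensity Q₁ Q)) (x : Fin (r + 1) → X D) (y : X D) :
    gradient (fun y => Real.log
        (density Q₁ Q (Fin.snoc (α := fun _ => X D) x y))) y =
      gradient (fun y => Real.log (Q (Fin.last r) (x (Fin.last r)) y)) y := by
  have hZ := integral_unnormDensity_pos hQ₁ hQ hint
  have hx := unnormDensity_pos (Q := fun i : Fin r => Q i.castSucc) hQ₁ (fun i => hQ _) x
  rw [← gradient_log_const_mul (mul_pos (inv_pos.mpr hZ) hx) (hQ (Fin.last r) _) y]
  congr 1
  funext y
  have h0 : (Fin.snoc (α := fun _ => X D) x y : Fin (r + 2) → X D) 0 = x 0 := by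
    exact Fin.snoc_castSucc (α := fun _ => X D) y x (0 : Fin (r + 1))
  have hs : ∀ i : Fin r, (Fin.snoc (α := fun _ => X D) x y : Fin (r + 2) → X D)
      i.castSucc.succ = x i.succ := fun i => by
    rw [Fin.succ_castSucc]
    exact Fin.snoc_castSucc (α := fun _ => X D) y x i.succ
  have hl : (Fin.snoc (α := fun _ => X D) x y : Fin (r + 2) → X D) (Fin.last r).succ = y := by
    rw [Fin.succ_last]
    exact Fin.snoc_last (α := fun _ => X D) y x
  simp only [density, unnormDensity, Fin.prod_univ_castSucc, h0, hs, hl, Fin.snoc_castSucc,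
    div_eq_inv_mul]
  congr 1
  ring

end ParticleAMALA

namespace ParticleAMALA

/-! ### Measures depending on a parameter -/

section Generic

variable {α β γ : Type*} [MeasurableSpace α] [MeasurableSpace β] [MeasurableSpace γ]

/-! The auxiliary variable turns the gradient proposal into an independent one. By symmetry of the
Gaussian density, `q x * N(u; drift x) = N(x; u) * potential u x` (`modifiedFactor_eq`). So if the
reference state has density `q` and `u` is drawn from it, then equivalently `u` has Lebesgue measure
and the state is drawn from `N(u)` with weight `potential`. Planting this state at position `k`
among independent draws from `N(u)` makes all particles exchangeable, and given them the reference
index carries weight proportional to `potential` (`lintegral_forward`). The ancestors behave alike: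
if the reference ancestor has law `W`, all of them are independent with law `W`
(`sum_lintegral_ancestors`). Both facts are instances of `lintegral_lintegral_pi_dirac`.

The invariance is an induction on the number of remaining time points. The invariant `Preserves`
fixes the current particles and weights: if the reference index follows the weights and the future
path has the model density, then the returned path has the law of the reference path. At the final
time this says that the forced move leaves `W` invariant, which follows from detailed balance
(`sum_lintegral_forcedMove`). In the inductive step (`Preserves.extend`), the law is rewritten as
above and the hypothesis is applied for fixed ancestors, `u` and new particles. It replaces the
selected future path by a reference path. The sum over its ancestors then equals the normaliser of
the backward-sampling probabilities and cancels, after which `u` integrates to one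
(`sum_lintegral_backward`).

The first time point is not special: it is a recursive call from a fictitious earlier time whose
particles all sit at `0` and whose outgoing factor `Q₁` ignores them (`lintegral_step`). All
identities concern integrals of nonnegative functions, so Tonelli applies throughout, and the
normalising constant enters only as a common factor. -/

theorem measurable_map_param {ν : Measure β} [SFinite ν] {φ : α → β → γ}
    (hφ : Measurable (Function.uncurry φ)) : Measurable fun a => ν.map (φ a) := by
  refine Measure.measurable_of_measurable_coe _ fun s hs => ?_
  have h : ∀ a, ν.map (φ a) s = ν (Prod.mk a ⁻¹' (Function.uncurry φ ⁻¹' s)) := fun a => by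
    have ha : Measurable (φ a) := hφ.comp measurable_prodMk_left
    rw [Measure.map_apply ha hs]
    rfl
  simp only [h]
  exact measurable_measure_prodMk_left (hφ hs)

theorem measurable_lintegral_param {m : α → Measure β} (hm : Measurable m)
    (hp : ∀ a, IsProbabilityMeasure (m a)) {f : α → β → ENNReal}
    (hf : Measurable (Function.uncurry f)) : Measurable fun a => ∫⁻ b, f a b ∂m a := by
  -- Unit mass makes this kernel s-finite, as integration with a parameter requires.
  let κ : Kernel α β := ⟨m, hm⟩
  have : IsMarkovKernel κ := ⟨hp⟩
  exact Measurable.lintegral_kernel_prod_right (κ := κ) hf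

theorem measurable_bind_param {m : α → Measure β} (hm : Measurable m)
    (hp : ∀ a, IsProbabilityMeasure (m a)) {g : α → β → Measure γ}
    (hg : Measurable (Function.uncurry g)) : Measurable fun a => (m a).bind (g a) := by
  refine Measure.measurable_of_measurable_coe _ fun s hs => ?_
  have h : ∀ a, (m a).bind (g a) s = ∫⁻ b, g a b s ∂m a := fun a =>
    Measure.bind_apply hs (hg.comp measurable_prodMk_left).aemeasurable
  simp only [h]
  exact measurable_lintegral_param hm hp ((Measure.measurable_coe hs).comp hg)

theorem isProbabilityMeasure_bind {m : Measure α} [IsProbabilityMeasure m] {g : α → Measure β}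
    (hg : Measurable g) (hp : ∀ a, IsProbabilityMeasure (g a)) :
    IsProbabilityMeasure (m.bind g) :=
  ⟨by simp [Measure.bind_apply MeasurableSet.univ hg.aemeasurable]⟩

/-- On a finite space the bind is a finite sum weighted by point masses, so measurability of each
mass and each branch suffices and total mass one is not needed. This serves all draws of indices. -/
theorem measurable_bind_finite [Finite β] [MeasurableSingletonClass β] {m : α → Measure β}
    (hm : ∀ b, Measurable fun a => m a {b}) {g : α → β → Measure γ}
    (hg : ∀ b, Measurable fun a => g a b) : Measurable fun a => (m a).bind (g a) := by
  cases nonempty_fintype β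
  refine Measure.measurable_of_measurable_coe _ fun s hs => ?_
  have h : ∀ a, (m a).bind (g a) s = ∑ b, g a b s * m a {b} := fun a => by
    rw [Measure.bind_apply hs (Measurable.of_discrete (f := g a)).aemeasurable, lintegral_fintype]
  simp only [h]
  exact Finset.measurable_sum _ fun b _ => ((Measure.measurable_coe hs).comp (hg b)).mul (hm b)

end Generic

/-! ### Product measures with one fixed coordinate -/

section Pi

variable {α : Type*} [MeasurableSpace α] {n : ℕ}

/-- Split off coordinate `k`; the remaining ones are numbered by `k.succAbove`, which never equals
`k`, so they all carry `μ`. -/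
theorem lintegral_pi_dirac {μ : Measure α} [IsProbabilityMeasure μ] (k : Fin (n + 1)) (x : α)
    {F : (Fin (n + 1) → α) → ENNReal} (hF : Measurable F) :
    ∫⁻ z, F z ∂(Measure.pi fun j => if j = k then Measure.dirac x else μ) =
      ∫⁻ z, F (k.insertNth x z) ∂(Measure.pi fun _ : Fin n => μ) := by
  have : ∀ j, IsProbabilityMeasure (if j = k then Measure.dirac x else μ) := fun j => by
    split_ifs <;> infer_instance
  have h := (measurePreserving_piFinSuccAbove
    (fun j : Fin (n + 1) => if j = k then Measure.dirac x else μ) k).symm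
  rw [← h.lintegral_comp hF]
  have hne : ∀ j : Fin n, (if k.succAbove j = k then Measure.dirac x else μ) = μ := fun j =>
    if_neg (Fin.succAbove_ne k j)
  simp only [if_true, hne]
  have hG : Measurable fun p : α × (Fin n → α) =>
      F ((MeasurableEquiv.piFinSuccAbove (fun _ => α) k).symm p) :=
    hF.comp (MeasurableEquiv.measurable _)
  rw [lintegral_prod _ hG.aemeasurable, lintegral_dirac' _ hG.lintegral_prod_right']
  rfl

/-- A planted coordinate that is itself distributed as `μ` cannot be told from the others. Applied
with a Gaussian `μ` to the particles and with a discrete `μ` to the ancestors. -/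
theorem lintegral_lintegral_pi_dirac {μ : Measure α} [IsProbabilityMeasure μ] (k : Fin (n + 1))
    {F : α → (Fin (n + 1) → α) → ENNReal} (hF : Measurable (Function.uncurry F)) :
    ∫⁻ x, ∫⁻ z, F x z ∂(Measure.pi fun j => if j = k then Measure.dirac x else μ) ∂μ =
      ∫⁻ z, F (z k) z ∂(Measure.pi fun _ : Fin (n + 1) => μ) := by
  have hF' : Measurable fun z : Fin (n + 1) → α => F (z k) z :=
    hF.comp (f := fun z : Fin (n + 1) → α => (z k, z))
      ((measurable_pi_apply k).prodMk measurable_id)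
  have hG : Measurable fun p : α × (Fin n → α) =>
      (fun z : Fin (n + 1) → α => F (z k) z)
        ((MeasurableEquiv.piFinSuccAbove (fun _ => α) k).symm p) :=
    hF'.comp (MeasurableEquiv.measurable _)
  rw [← (measurePreserving_piFinSuccAbove (fun _ : Fin (n + 1) => μ) k).symm.lintegral_comp hF',
    lintegral_prod _ hG.aemeasurable]
  refine lintegral_congr fun x => ?_
  rw [lintegral_pi_dirac k x (F := F x) (hF.comp measurable_prodMk_left)]
  refine lintegral_congr fun z => ?_
  change F x (k.insertNth x z) = F ((k.insertNth x z : Fin (n + 1) → α) k) (k.insertNth x z)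
  rw [Fin.insertNth_apply_same]

theorem lintegral_pi_eval {μ : Measure α} [IsProbabilityMeasure μ] (k : Fin (n + 1))
    {F : α → ENNReal} (hF : Measurable F) :
    ∫⁻ z, F (z k) ∂(Measure.pi fun _ : Fin (n + 1) => μ) = ∫⁻ x, F x ∂μ :=
  (MeasureTheory.measurePreserving_eval (fun _ : Fin (n + 1) => μ) k).lintegral_comp hF

theorem lintegral_fin_cons {D r : ℕ} {F : (Fin (r + 1) → X D) → ENNReal} (hF : Measurable F) :
    ∫⁻ x, F x = ∫⁻ y : X D, ∫⁻ x' : Fin r → X D, F (Fin.cons y x') := by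
  have hG : Measurable fun p : X D × (Fin r → X D) =>
      F ((MeasurableEquiv.piFinSuccAbove (fun _ => X D) 0).symm p) :=
    hF.comp (MeasurableEquiv.measurable _)
  rw [← (volume_preserving_piFinSuccAbove (fun _ : Fin (r + 1) => X D) 0).symm.lintegral_comp hF,
    Measure.volume_eq_prod, lintegral_prod _ hG.aemeasurable]
  refine lintegral_congr fun x => lintegral_congr fun z => ?_
  change F (Fin.insertNth 0 x z) = _
  rw [Fin.insertNth_zero]
  rfl

end Pi

theorem measurable_fin_cons {D r : ℕ} :
    Measurable fun p : X D × (Fin r → X D) =>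
      (Fin.cons p.1 p.2 : Fin (r + 1) → X D) := by
  refine measurable_pi_iff.2 fun i => ?_
  refine Fin.cases ?_ (fun j => ?_) i
  · simpa using measurable_fst
  · exact (measurable_pi_apply j).comp measurable_snd

theorem measurable_fin_tail {D r : ℕ} :
    Measurable fun x : Fin (r + 1) → X D => (Fin.tail x : Fin r → X D) :=
  measurable_pi_iff.2 fun i => measurable_pi_apply i.succ

/-! ### Distributions on the indices -/

section Discrete

variable {N : ℕ}

theorem lintegral_discrete (p : Fin (N + 1) → ℝ) (f : Fin (N + 1) → ENNReal) :
    ∫⁻ i, f i ∂discrete p = ∑ i, ENNReal.ofReal (p i) * f i := by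
  simp [discrete, lintegral_finsetSum_measure, lintegral_smul_measure]

theorem discrete_singleton (p : Fin (N + 1) → ℝ) (i : Fin (N + 1)) :
    discrete p {i} = ENNReal.ofReal (p i) := by
  rw [← setLIntegral_one, ← lintegral_indicator (measurableSet_singleton i), lintegral_discrete,
    Finset.sum_eq_single i]
  · simp
  · intro j _ hj
    simp [hj]
  · simp

theorem isProbabilityMeasure_discrete {p : Fin (N + 1) → ℝ} (h0 : ∀ i, 0 ≤ p i)
    (h1 : ∑ i, p i = 1) : IsProbabilityMeasure (discrete p) :=
  ⟨by rw [← setLIntegral_one, Measure.restrict_univ, lintegral_discrete]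
      simp [← ENNReal.ofReal_sum_of_nonneg fun i _ => h0 i, h1]⟩

/-- Needed for arbitrary `p`: measurability in the weights ranges over all real vectors, not just
normalised ones. -/
instance (p : Fin (N + 1) → ℝ) : IsFiniteMeasure (discrete p) :=
  ⟨by rw [← setLIntegral_one, Measure.restrict_univ, lintegral_discrete]
      simp [ENNReal.sum_lt_top]⟩

theorem sum_pos_of_pos {w : Fin (N + 1) → ℝ} (hw : ∀ i, 0 < w i) : 0 < ∑ i, w i :=
  Finset.sum_pos (fun i _ => hw i) Finset.univ_nonempty

theorem normalize_pos {w : Fin (N + 1) → ℝ} (hw : ∀ i, 0 < w i) (i : Fin (N + 1)) :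
    0 < normalize w i := div_pos (hw i) (sum_pos_of_pos hw)

theorem sum_normalize {w : Fin (N + 1) → ℝ} (hw : ∀ i, 0 < w i) : ∑ i, normalize w i = 1 := by
  simp only [normalize, ← Finset.sum_div]
  exact div_self (sum_pos_of_pos hw).ne'

theorem measurable_normalize {α : Type*} [MeasurableSpace α] {w : α → Fin (N + 1) → ℝ}
    (hw : Measurable w) : Measurable fun a => normalize (w a) := by
  refine measurable_pi_iff.2 fun i => ?_
  unfold normalize
  have h : ∀ i, Measurable fun a => w a i := fun i => (measurable_pi_apply i).comp hw
  exact (h i).div (Finset.measurable_sum _ fun j _ => h j)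

instance : IsProbabilityMeasure (uniformIndex N) :=
  isProbabilityMeasure_discrete (fun _ => by positivity) (by
    have : (N : ℝ) + 1 ≠ 0 := by positivity
    simp [this])

theorem isProbabilityMeasure_ancestors {W : Fin (N + 1) → ℝ} (h0 : ∀ i, 0 ≤ W i)
    (h1 : ∑ i, W i = 1) (k k' : Fin (N + 1)) : IsProbabilityMeasure (ancestors W k k') := by
  have := isProbabilityMeasure_discrete h0 h1
  have : ∀ n, IsProbabilityMeasure (if n = k' then Measure.dirac k else discrete W) := fun n => by
    split_ifs <;> infer_instance
  unfold ancestors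
  infer_instance

theorem measurable_ancestors_singleton (k k' : Fin (N + 1)) (a : Fin (N + 1) → Fin (N + 1)) :
    Measurable fun W : Fin (N + 1) → ℝ => ancestors W k k' {a} := by
  have h : ∀ W : Fin (N + 1) → ℝ, ancestors W k k' {a} =
      ∏ n, if n = k' then Measure.dirac k {a n} else ENNReal.ofReal (W (a n)) := fun W => by
    have : ∀ n, IsFiniteMeasure (if n = k' then Measure.dirac k else discrete W) := fun n => by
      split_ifs <;> infer_instance
    rw [ancestors, Measure.pi_singleton]
    refine Finset.prod_congr rfl fun n _ => ?_
    split_ifs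
    · rfl
    · exact discrete_singleton W (a n)
  simp only [h]
  refine Finset.measurable_prod _ fun n _ => ?_
  split_ifs
  · exact measurable_const
  · exact (measurable_pi_apply _).ennreal_ofReal

end Discrete

/-! ### Gaussian distributions -/

section Gaussian

variable {D : ℕ}

theorem gaussianDensity_pos (m : X D) {v : ℝ} (hv : 0 < v) (x : X D) :
    0 < gaussianDensity m v x := by
  unfold gaussianDensity
  have := Real.pi_pos
  positivity

theorem gaussianDensity_comm (m : X D) (v : ℝ) (x : X D) :
    gaussianDensity m v x = gaussianDensity x v m := by
  simp only [gaussianDensity, norm_sub_rev]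

theorem measurable_gaussianDensity {α : Type*} [MeasurableSpace α] (v : ℝ) {m x : α → X D}
    (hm : Measurable m) (hx : Measurable x) :
    Measurable fun a => gaussianDensity (m a) v (x a) := by
  unfold gaussianDensity
  fun_prop

theorem lintegral_gaussian (m : X D) (v : ℝ) {f : X D → ENNReal} (hf : Measurable f) :
    ∫⁻ x, f x ∂gaussian m v = ∫⁻ x, ENNReal.ofReal (gaussianDensity m v x) * f x := by
  have hm : Measurable fun x => ENNReal.ofReal (gaussianDensity m v x) :=
    (measurable_gaussianDensity v measurable_const measurable_id).ennreal_ofReal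
  rw [gaussian, lintegral_withDensity_eq_lintegral_mul _ hm hf]
  rfl

/-- Translation invariance of Lebesgue measure. Writing every Gaussian as an image of one fixed law
reduces its mass to the centred case and gives measurability in the mean. -/
theorem gaussian_eq_map (m : X D) (v : ℝ) : gaussian m v = (gaussian 0 v).map (m + ·) := by
  refine Measure.ext_of_lintegral _ fun f hf => ?_
  rw [lintegral_map hf (measurable_const_add m), lintegral_gaussian m v hf,
    lintegral_gaussian 0 v (f := fun x => f (m + x)) (hf.comp (measurable_const_add m)),
    ← lintegral_add_left_eq_self _ m]
  refine lintegral_congr fun x => ?_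
  simp [gaussianDensity]

theorem lintegral_gaussianDensity {v : ℝ} (hv : 0 < v) :
    ∫⁻ x : X D, ENNReal.ofReal (gaussianDensity 0 v x) = 1 := by
  have hb : 0 < (2 * v)⁻¹ := by positivity
  have h1 := GaussianFourier.integral_rexp_neg_mul_sq_norm (V := X D) hb
  have h2 : ∀ x : X D, gaussianDensity 0 v x =
      ((Real.sqrt (2 * Real.pi * v)) ^ D)⁻¹ * Real.exp (-(2 * v)⁻¹ * ‖x‖ ^ 2) := fun x => by
    simp only [gaussianDensity, sub_zero]
    congr 2
    field_simp
  have hpi := Real.pi_pos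
  have h3 : (Real.pi / (2 * v)⁻¹) ^ (Module.finrank ℝ (X D) / 2 : ℝ) =
      (Real.sqrt (2 * Real.pi * v)) ^ D := by
    rw [finrank_euclideanSpace_fin, Real.sqrt_eq_rpow, ← Real.rpow_natCast, ← Real.rpow_mul
      (by positivity)]
    congr 1
    · field_simp
    · ring
  have h4 : ∫ x : X D, gaussianDensity 0 v x = 1 := by
    simp only [h2]
    rw [integral_const_mul, h1, h3]
    exact inv_mul_cancel₀ (by positivity)
  -- A non-integrable function would have Bochner integral `0`, contradicting the value `1`.
  have hint : Integrable fun x : X D => gaussianDensity 0 v x := by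
    by_contra h
    rw [integral_undef h] at h4
    exact zero_ne_one h4
  rw [← ofReal_integral_eq_lintegral_ofReal hint
    (Filter.Eventually.of_forall fun x => (gaussianDensity_pos 0 hv x).le), h4, ENNReal.ofReal_one]

theorem isProbabilityMeasure_gaussian (m : X D) {v : ℝ} (hv : 0 < v) :
    IsProbabilityMeasure (gaussian m v) := by
  have : IsProbabilityMeasure (gaussian (0 : X D) v) :=
    ⟨by rw [gaussian, withDensity_apply _ MeasurableSet.univ, Measure.restrict_univ,
      lintegral_gaussianDensity hv]⟩
  rw [gaussian_eq_map]
  exact Measure.isProbabilityMeasure_map (measurable_const_add m).aemeasurable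

theorem lintegral_gaussianDensity_left (m : X D) {v : ℝ} (hv : 0 < v) :
    ∫⁻ x : X D, ENNReal.ofReal (gaussianDensity m v x) = 1 := by
  have := isProbabilityMeasure_gaussian m hv
  simpa using (lintegral_gaussian m v measurable_one).symm

end Gaussian

/-! ### Measurability of the sampling steps -/

section Steps

variable {D N : ℕ}

/-- The partial derivative of a jointly continuous function is jointly measurable, with the default
value `0` where it does not exist. Hence continuity of the factors is all that the rest of the proof
asks for. -/
theorem measurable_drift {α : Type*} [MeasurableSpace α] (κ δ : ℝ) {q : X D → X D → ℝ}
    (hpos : ∀ x y, 0 < q x y) (hcont : Continuous (Function.uncurry q)) {x y : α → X D}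
    (hx : Measurable x) (hy : Measurable y) :
    Measurable fun a => drift κ δ (q (x a)) (y a) := by
  have hlog : Continuous (Function.uncurry fun x y => Real.log (q x y)) :=
    hcont.log fun p => (hpos p.1 p.2).ne'
  have hf := measurable_fderiv_with_param ℝ hlog
  have hg : Measurable fun p : X D × X D => gradient (fun y => Real.log (q p.1 y)) p.2 :=
    (InnerProductSpace.toDual ℝ (X D)).symm.continuous.measurable.comp hf
  exact hy.add ((hg.comp (hx.prodMk hy)).const_smul (κ * (δ / 2)))

theorem measurable_potential {α : Type*} [MeasurableSpace α] (κ δ : ℝ) {q : X D → X D → ℝ}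
    (hpos : ∀ x y, 0 < q x y) (hcont : Continuous (Function.uncurry q)) {x u y : α → X D}
    (hx : Measurable x) (hu : Measurable u) (hy : Measurable y) :
    Measurable fun a => potential κ δ (q (x a)) (u a) (y a) := by
  have hq : Measurable fun a => q (x a) (y a) := hcont.measurable.comp (hx.prodMk hy)
  exact hq.mul ((measurable_gaussianDensity _ (measurable_drift κ δ hpos hcont hx hy) hu).div
    (measurable_gaussianDensity _ hy hu))

theorem potential_pos (κ : ℝ) {δ : ℝ} (hδ : 0 < δ) {q : X D → ℝ} (hpos : ∀ x, 0 < q x)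
    (u x : X D) : 0 < potential κ δ q u x :=
  mul_pos (hpos x) (div_pos (gaussianDensity_pos _ (half_pos hδ) _)
    (gaussianDensity_pos _ (half_pos hδ) _))

/-- The denominator `N(u; x)` of the potential equals `N(x; u)` by symmetry and cancels. As a
function of `u`, what remains is a constant times a probability density. -/
theorem modifiedFactor_eq (κ : ℝ) {δ : ℝ} (hδ : 0 < δ) (q : X D → ℝ) (u x : X D) :
    modifiedFactor κ δ q u x = q x * gaussianDensity (drift κ δ q x) (δ / 2) u := by
  have h := (gaussianDensity_pos u (half_pos hδ) x).ne'
  rw [modifiedFactor, potential, gaussianDensity_comm x]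
  field_simp

theorem modifiedFactor_pos (κ : ℝ) {δ : ℝ} (hδ : 0 < δ) {q : X D → ℝ} (hpos : ∀ x, 0 < q x)
    (u x : X D) : 0 < modifiedFactor κ δ q u x :=
  mul_pos (gaussianDensity_pos _ (half_pos hδ) _) (potential_pos κ hδ hpos u x)

theorem measurable_modifiedFactor {α : Type*} [MeasurableSpace α] (κ δ : ℝ)
    {q : X D → X D → ℝ} (hpos : ∀ x y, 0 < q x y) (hcont : Continuous (Function.uncurry q))
    {x u y : α → X D} (hx : Measurable x) (hu : Measurable u) (hy : Measurable y) :
    Measurable fun a => modifiedFactor κ δ (q (x a)) (u a) (y a) :=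
  (measurable_gaussianDensity _ hu hy).mul (measurable_potential κ δ hpos hcont hx hu hy)

theorem measurable_gaussian (v : ℝ) (hv : 0 < v) : Measurable fun m : X D => gaussian m v := by
  have := isProbabilityMeasure_gaussian (0 : X D) hv
  have h : (fun m : X D => gaussian m v) = fun m => (gaussian 0 v).map (m + ·) :=
    funext fun m => gaussian_eq_map m v
  rw [h]
  exact measurable_map_param (φ := fun m x : X D => m + x) (measurable_fst.add measurable_snd)

theorem isProbabilityMeasure_particles {δ : ℝ} (hδ : 0 < δ) (u x : X D) (k : Fin (N + 1)) :
    IsProbabilityMeasure (particles δ u x k) := by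
  have := isProbabilityMeasure_gaussian u (half_pos hδ)
  have : ∀ n, IsProbabilityMeasure (if n = k then Measure.dirac x else gaussian u (δ / 2)) :=
    fun n => by split_ifs <;> infer_instance
  unfold particles
  infer_instance

theorem measurable_particles {α : Type*} [MeasurableSpace α] {δ : ℝ} (hδ : 0 < δ)
    (k : Fin (N + 1)) {u x : α → X D} (hu : Measurable u) (hx : Measurable x) :
    Measurable fun a => particles δ (u a) (x a) k := by
  have := isProbabilityMeasure_gaussian (0 : X D) (half_pos hδ)
  -- A fixed law of centred Gaussians carries all the randomness; the reference coordinate is its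
  -- image under a constant map.
  have h : ∀ u x : X D, particles δ u x k =
      (Measure.pi fun _ : Fin (N + 1) => gaussian (0 : X D) (δ / 2)).map
        fun z n => if n = k then x else u + z n := fun u x => by
    have hm : ∀ n, Measurable fun y : X D => if n = k then x else u + y := fun n => by
      split_ifs
      · exact measurable_const
      · exact measurable_const_add _
    have : ∀ n, SigmaFinite ((gaussian (0 : X D) (δ / 2)).map
        fun y : X D => if n = k then x else u + y) := fun n => by
      have := Measure.isProbabilityMeasure_map (μ := gaussian (0 : X D) (δ / 2))
        (hm n).aemeasurable
      infer_instance
    rw [Measure.pi_map_pi (f := fun (n : Fin (N + 1)) (y : X D) => if n = k then x else u + y)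
      fun n => (hm n).aemeasurable, particles]
    congr 1
    funext n
    split_ifs
    · rw [Measure.map_const, measure_univ, one_smul]
    · exact gaussian_eq_map _ _
  simp only [h]
  refine measurable_map_param (φ := fun a (z : Fin (N + 1) → X D) n =>
    if n = k then x a else u a + z n) ?_
  refine measurable_pi_iff.2 fun n => ?_
  change Measurable fun p : α × (Fin (N + 1) → X D) =>
    if n = k then x p.1 else u p.1 + p.2 n
  split_ifs <;> fun_prop

theorem measurable_discrete_singleton {α : Type*} [MeasurableSpace α] {p : α → Fin (N + 1) → ℝ}
    (hp : Measurable p) (i : Fin (N + 1)) : Measurable fun a => discrete (p a) {i} := by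
  simp only [discrete_singleton]
  exact ((measurable_pi_apply i).comp hp).ennreal_ofReal

theorem measurable_forcedMove (k : Fin (N + 1)) :
    Measurable fun W : Fin (N + 1) → ℝ => forcedMove W k := by
  refine measurable_bind_finite (m := fun W : Fin (N + 1) → ℝ =>
    discrete fun i => if i = k then 0 else W i / (1 - W k)) (fun i => ?_) fun i => ?_
  · refine measurable_discrete_singleton (measurable_pi_iff.2 fun j => ?_) i
    split_ifs <;> fun_prop
  · refine Measurable.add (Measurable.smul_measure ?_ _) (Measurable.smul_measure ?_ _) <;>
    fun_prop

theorem measurable_backward_singleton {α : Type*} [MeasurableSpace α] (κ δ : ℝ)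
    {q : X D → X D → ℝ} (hpos : ∀ x y, 0 < q x y) (hcont : Continuous (Function.uncurry q))
    {u y : α → X D} {W : α → Fin (N + 1) → ℝ} {z : α → Fin (N + 1) → X D} (hu : Measurable u)
    (hW : Measurable W) (hz : Measurable z) (hy : Measurable y) (i : Fin (N + 1)) :
    Measurable fun a => backward κ δ q (u a) (W a) (z a) (y a) {i} := by
  refine measurable_discrete_singleton (measurable_normalize (measurable_pi_iff.2 fun n => ?_)) i
  exact ((measurable_pi_apply n).comp hW).mul
    (measurable_modifiedFactor κ δ hpos hcont ((measurable_pi_apply n).comp hz) hu hy)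

theorem isProbabilityMeasure_backward (κ : ℝ) {δ : ℝ} (hδ : 0 < δ) {q : X D → X D → ℝ}
    (hpos : ∀ x y, 0 < q x y) (u : X D) {W : Fin (N + 1) → ℝ} (hW : ∀ i, 0 < W i)
    (z : Fin (N + 1) → X D) (y : X D) : IsProbabilityMeasure (backward κ δ q u W z y) := by
  have h : ∀ i, 0 < W i * modifiedFactor κ δ (q (z i)) u y := fun i =>
    mul_pos (hW i) (modifiedFactor_pos κ hδ (hpos _) u y)
  exact isProbabilityMeasure_discrete (fun i => (normalize_pos h i).le) (sum_normalize h)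

/-- The normalised weights after a forward step. -/
noncomputable def newWeights (κ δ : ℝ) (q : X D → X D → ℝ) (z : Fin (N + 1) → X D)
    (a : Fin (N + 1) → Fin (N + 1)) (u : X D) (z' : Fin (N + 1) → X D) : Fin (N + 1) → ℝ :=
  normalize fun n => potential κ δ (q (z (a n))) u (z' n)

theorem measurable_newWeights {α : Type*} [MeasurableSpace α] (κ δ : ℝ) {q : X D → X D → ℝ}
    (hpos : ∀ x y, 0 < q x y) (hcont : Continuous (Function.uncurry q))
    {z z' : α → Fin (N + 1) → X D} {u : α → X D} (hz : Measurable z) (hu : Measurable u)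
    (hz' : Measurable z') (a : Fin (N + 1) → Fin (N + 1)) :
    Measurable fun p => newWeights κ δ q (z p) a (u p) (z' p) :=
  measurable_normalize (measurable_pi_iff.2 fun n =>
    measurable_potential κ δ hpos hcont ((measurable_pi_apply (a n)).comp hz) hu
      ((measurable_pi_apply n).comp hz'))

theorem lintegral_forcedMove (W : Fin (N + 1) → ℝ) (k : Fin (N + 1)) (f : Fin (N + 1) → ENNReal) :
    ∫⁻ l, f l ∂forcedMove W k =
      ∑ i, ENNReal.ofReal (if i = k then 0 else W i / (1 - W k)) *
        (ENNReal.ofReal (min 1 ((1 - W k) / (1 - W i))) * f i +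
          ENNReal.ofReal (1 - min 1 ((1 - W k) / (1 - W i))) * f k) := by
  rw [forcedMove, Measure.lintegral_bind Measurable.of_discrete.aemeasurable
    Measurable.of_discrete.aemeasurable, lintegral_discrete]
  simp

end Steps

/-! ### The forced move -/

section ForcedMove

variable {N : ℕ}

/-- A second index with positive weight exists, which keeps the denominators of the forced move
positive. -/
theorem lt_one_of_sum_eq_one (hN : 1 ≤ N) {W : Fin (N + 1) → ℝ} (hW : ∀ i, 0 < W i)
    (h1 : ∑ i, W i = 1) (k : Fin (N + 1)) : W k < 1 := by
  have : Nontrivial (Fin (N + 1)) := Fin.nontrivial_iff_two_le.2 (by omega)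
  obtain ⟨j, hj⟩ := exists_ne k
  rw [← h1]
  exact Finset.single_lt_sum hj (Finset.mem_univ _) (Finset.mem_univ _) (hW j)
    fun i _ _ => (hW i).le

theorem sum_forcedMove_proposal (hN : 1 ≤ N) {W : Fin (N + 1) → ℝ} (hW : ∀ i, 0 < W i)
    (h1 : ∑ i, W i = 1) (k : Fin (N + 1)) :
    ∑ i, (if i = k then 0 else W i / (1 - W k)) = 1 := by
  have hk : 1 - W k ≠ 0 := (sub_pos.2 (lt_one_of_sum_eq_one hN hW h1 k)).ne'
  have h : ∀ i, (if i = k then 0 else W i / (1 - W k)) =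
      (W i - if i = k then W k else 0) / (1 - W k) := fun i => by
    split_ifs with h
    · simp [h]
    · simp
  simp only [h, ← Finset.sum_div, Finset.sum_sub_distrib, h1, Finset.sum_ite_eq', Finset.mem_univ,
    if_true]
  exact div_self hk

theorem forcedMove_proposal_nonneg (hN : 1 ≤ N) {W : Fin (N + 1) → ℝ} (hW : ∀ i, 0 < W i)
    (h1 : ∑ i, W i = 1) (k i : Fin (N + 1)) : 0 ≤ if i = k then 0 else W i / (1 - W k) := by
  split_ifs
  · exact le_rfl
  · exact div_nonneg (hW i).le (sub_pos.2 (lt_one_of_sum_eq_one hN hW h1 k)).le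

theorem forcedMove_acceptance_nonneg (hN : 1 ≤ N) {W : Fin (N + 1) → ℝ} (hW : ∀ i, 0 < W i)
    (h1 : ∑ i, W i = 1) (k i : Fin (N + 1)) : 0 ≤ min 1 ((1 - W k) / (1 - W i)) :=
  le_min zero_le_one (div_nonneg (sub_pos.2 (lt_one_of_sum_eq_one hN hW h1 k)).le
    (sub_pos.2 (lt_one_of_sum_eq_one hN hW h1 i)).le)

theorem isProbabilityMeasure_forcedMove (hN : 1 ≤ N) {W : Fin (N + 1) → ℝ} (hW : ∀ i, 0 < W i)
    (h1 : ∑ i, W i = 1) (k : Fin (N + 1)) : IsProbabilityMeasure (forcedMove W k) := by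
  have := isProbabilityMeasure_discrete (forcedMove_proposal_nonneg hN hW h1 k)
    (sum_forcedMove_proposal hN hW h1 k)
  refine isProbabilityMeasure_bind Measurable.of_discrete fun i => ⟨?_⟩
  have h := forcedMove_acceptance_nonneg hN hW h1 k i
  simp only [Measure.add_apply, Measure.smul_apply, measure_univ, smul_eq_mul, mul_one]
  rw [← ENNReal.ofReal_add h (sub_nonneg.2 (min_le_left _ _))]
  simp

/-- The flow of probability from `k` to `i ≠ k` under the forced move is symmetric. -/
theorem forcedMove_flow_symm (hN : 1 ≤ N) {W : Fin (N + 1) → ℝ} (hW : ∀ i, 0 < W i)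
    (h1 : ∑ i, W i = 1) (k i : Fin (N + 1)) :
    W k * ((if i = k then 0 else W i / (1 - W k)) * min 1 ((1 - W k) / (1 - W i))) =
      W i * ((if k = i then 0 else W k / (1 - W i)) * min 1 ((1 - W i) / (1 - W k))) := by
  have hk := sub_pos.2 (lt_one_of_sum_eq_one hN hW h1 k)
  have hi := sub_pos.2 (lt_one_of_sum_eq_one hN hW h1 i)
  by_cases h : i = k
  · simp [h]
  · rw [if_neg h, if_neg (Ne.symm h)]
    -- One of the two minima is `1`, the other is the ratio; both sides equal `W k * W i / max (1 -
    -- W k) (1 - W i)`.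
    rcases le_total (1 - W k) (1 - W i) with hle | hle
    · rw [min_eq_right ((div_le_one hi).2 hle), min_eq_left ((one_le_div hk).2 hle)]
      field_simp
    · rw [min_eq_left ((one_le_div hi).2 hle), min_eq_right ((div_le_one hk).2 hle)]
      field_simp

/-- The forced move leaves the law with weights `W` invariant. -/
theorem sum_lintegral_forcedMove (hN : 1 ≤ N) {W : Fin (N + 1) → ℝ} (hW : ∀ i, 0 < W i)
    (h1 : ∑ i, W i = 1) (f : Fin (N + 1) → ENNReal) :
    ∑ k, ENNReal.ofReal (W k) * ∫⁻ l, f l ∂forcedMove W k = ∑ k, ENNReal.ofReal (W k) * f k := by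
  have hp := forcedMove_proposal_nonneg hN hW h1
  have ha := forcedMove_acceptance_nonneg hN hW h1
  set p : Fin (N + 1) → Fin (N + 1) → ℝ := fun k i => if i = k then 0 else W i / (1 - W k) with hp'
  set A : Fin (N + 1) → Fin (N + 1) → ℝ := fun k i => min 1 ((1 - W k) / (1 - W i)) with hA'
  have hflow : ∀ k i, W k * (p k i * A k i) = W i * (p i k * A i k) :=
    forcedMove_flow_symm hN hW h1
  have hA1 : ∀ k i, 0 ≤ 1 - A k i := fun k i => sub_nonneg.2 (min_le_left _ _)
  have hsum : ∀ k, ∑ i, p k i = 1 := sum_forcedMove_proposal hN hW h1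
  calc ∑ k, ENNReal.ofReal (W k) * ∫⁻ l, f l ∂forcedMove W k
      = ∑ k, ∑ i, (ENNReal.ofReal (W k * (p k i * A k i)) * f i +
          ENNReal.ofReal (W k * (p k i * (1 - A k i))) * f k) := by
        refine Finset.sum_congr rfl fun k _ => ?_
        rw [lintegral_forcedMove, Finset.mul_sum]
        refine Finset.sum_congr rfl fun i _ => ?_
        rw [ENNReal.ofReal_mul (hW k).le, ENNReal.ofReal_mul (hW k).le,
          ENNReal.ofReal_mul (hp k i), ENNReal.ofReal_mul (hp k i)]
        ring
    _ = ∑ k, ∑ i, (ENNReal.ofReal (W k * (p k i * A k i)) * f k +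
          ENNReal.ofReal (W k * (p k i * (1 - A k i))) * f k) := by
        simp only [Finset.sum_add_distrib]
        congr 1
        -- Exchanging the names of the two indices and using detailed balance turns `f i` into `f k`
        -- in the accepted part.
        rw [Finset.sum_comm]
        simp only [hflow]
    _ = ∑ k, ∑ i, ENNReal.ofReal (W k * p k i) * f k := by
        refine Finset.sum_congr rfl fun k _ => Finset.sum_congr rfl fun i _ => ?_
        rw [← add_mul, ← ENNReal.ofReal_add
          (mul_nonneg (hW k).le (mul_nonneg (hp k i) (ha k i)))
          (mul_nonneg (hW k).le (mul_nonneg (hp k i) (hA1 k i)))]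
        congr 2
        ring
    _ = ∑ k, ENNReal.ofReal (W k) * f k := by
        refine Finset.sum_congr rfl fun k _ => ?_
        rw [← Finset.sum_mul, ← ENNReal.ofReal_sum_of_nonneg
          fun i _ => mul_nonneg (hW k).le (hp k i), ← Finset.mul_sum, hsum, mul_one]

end ForcedMove

/-! ### One recursive call of the algorithm -/

section Extend

variable {D N r : ℕ}

/-- Backward sampling at the current time point followed by the composition of the path. -/
noncomputable def backStep (κ δ : ℝ) (q : X D → X D → ℝ) (u : X D) (W : Fin (N + 1) → ℝ)
    (z : Fin (N + 1) → X D) (y : Fin (r + 1) → X D) : Measure (Fin (r + 2) → X D) :=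
  (backward κ δ q u W z (y 0)).bind fun l => Measure.dirac (Fin.cons (z l) y)

/-- The forward step, the rest `K` of the algorithm and the backward step. -/
noncomputable def extend (κ δ : ℝ) (q : X D → X D → ℝ)
    (K : (Fin (r + 1) → X D) → Fin (N + 1) → (Fin (N + 1) → X D) → (Fin (N + 1) → ℝ) →
      Measure (Fin (r + 1) → X D))
    (x : Fin (r + 2) → X D) (k : Fin (N + 1)) (z : Fin (N + 1) → X D) (W : Fin (N + 1) → ℝ) :
    Measure (Fin (r + 2) → X D) :=
  (uniformIndex N).bind fun k' =>
  (ancestors W k k').bind fun a =>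
  (gaussian (drift κ δ (q (x 0)) (x 1)) (δ / 2)).bind fun u =>
  (particles δ u (x 1) k').bind fun z' =>
  (K (Fin.tail x) k' z' (newWeights κ δ q z a u z')).bind fun y => backStep κ δ q u W z y

/-- Keeping the remaining time points abstract as `K` allows one call to be analysed from the
properties of `K` alone. -/
theorem continueFrom_succ (κ : ℝ) (δ : Fin (r + 1) → ℝ) (Q : Fin (r + 1) → X D → X D → ℝ)
    (x : Fin (r + 2) → X D) (k : Fin (N + 1)) (z : Fin (N + 1) → X D) (W : Fin (N + 1) → ℝ) :
    continueFrom κ (r + 1) δ Q x k z W =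
      extend κ (δ 0) (Q 0) (continueFrom κ r (Fin.tail δ) (Fin.tail Q)) x k z W := rfl

/-- Joint measurability, and total mass one for normalised positive weights. -/
structure IsContinuation (K : (Fin (r + 1) → X D) → Fin (N + 1) → (Fin (N + 1) → X D) →
    (Fin (N + 1) → ℝ) → Measure (Fin (r + 1) → X D)) : Prop where
  measurable : ∀ k, Measurable
    fun p : (Fin (r + 1) → X D) × (Fin (N + 1) → X D) × (Fin (N + 1) → ℝ) => K p.1 k p.2.1 p.2.2
  isProbabilityMeasure : ∀ x k z W, (∀ i, 0 < W i) → ∑ i, W i = 1 →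
    IsProbabilityMeasure (K x k z W)

variable {κ δ : ℝ} {q : X D → X D → ℝ}
  {K : (Fin (r + 1) → X D) → Fin (N + 1) → (Fin (N + 1) → X D) → (Fin (N + 1) → ℝ) →
    Measure (Fin (r + 1) → X D)}
  {α : Type*} [MeasurableSpace α]

theorem measurable_backStep (hpos : ∀ x y, 0 < q x y) (hcont : Continuous (Function.uncurry q))
    {u : α → X D} {W : α → Fin (N + 1) → ℝ} {z : α → Fin (N + 1) → X D}
    {y : α → Fin (r + 1) → X D} (hu : Measurable u) (hW : Measurable W) (hz : Measurable z)
    (hy : Measurable y) : Measurable fun a => backStep κ δ q (u a) (W a) (z a) (y a) :=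
  measurable_bind_finite
    (measurable_backward_singleton κ δ hpos hcont hu hW hz ((measurable_pi_apply 0).comp hy))
    fun l => Measure.measurable_dirac.comp
      (measurable_fin_cons.comp (((measurable_pi_apply l).comp hz).prodMk hy))

theorem newWeights_pos (hδ : 0 < δ) (hpos : ∀ x y, 0 < q x y) (z : Fin (N + 1) → X D)
    (a : Fin (N + 1) → Fin (N + 1)) (u : X D) (z' : Fin (N + 1) → X D) (i : Fin (N + 1)) :
    0 < newWeights κ δ q z a u z' i :=
  normalize_pos (fun _ => potential_pos κ hδ (hpos _) _ _) i

theorem sum_newWeights (hδ : 0 < δ) (hpos : ∀ x y, 0 < q x y) (z : Fin (N + 1) → X D)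
    (a : Fin (N + 1) → Fin (N + 1)) (u : X D) (z' : Fin (N + 1) → X D) :
    ∑ i, newWeights κ δ q z a u z' i = 1 :=
  sum_normalize fun _ => potential_pos κ hδ (hpos _) _ _

theorem IsContinuation.isProbabilityMeasure_newWeights (hK : IsContinuation K) (hδ : 0 < δ)
    (hpos : ∀ x y, 0 < q x y) (x : Fin (r + 1) → X D) (k : Fin (N + 1)) (z : Fin (N + 1) → X D)
    (a : Fin (N + 1) → Fin (N + 1)) (u : X D) (z' : Fin (N + 1) → X D) :
    IsProbabilityMeasure (K x k z' (newWeights κ δ q z a u z')) :=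
  hK.isProbabilityMeasure _ _ _ _ (newWeights_pos hδ hpos z a u z') (sum_newWeights hδ hpos z a u z')

theorem IsContinuation.measurable_newWeights (hK : IsContinuation K) (hpos : ∀ x y, 0 < q x y)
    (hcont : Continuous (Function.uncurry q)) (k' : Fin (N + 1))
    (a : Fin (N + 1) → Fin (N + 1)) {x : α → Fin (r + 1) → X D} {z z' : α → Fin (N + 1) → X D}
    {u : α → X D} (hx : Measurable x) (hz : Measurable z) (hu : Measurable u)
    (hz' : Measurable z') :
    Measurable fun p => K (x p) k' (z' p) (newWeights κ δ q (z p) a (u p) (z' p)) :=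
  (hK.measurable k').comp
    (hx.prodMk (hz'.prodMk (ParticleAMALA.measurable_newWeights κ δ hpos hcont hz hu hz' a)))

/-- The stages of a call are treated from the inside out. All arguments are measurable functions of
a parameter, so that constants may be inserted when a single bind is unfolded. -/
theorem IsContinuation.measurable_select (hK : IsContinuation K) (hδ : 0 < δ)
    (hpos : ∀ x y, 0 < q x y) (hcont : Continuous (Function.uncurry q)) (k' : Fin (N + 1))
    (a : Fin (N + 1) → Fin (N + 1)) {x : α → Fin (r + 1) → X D} {z z' : α → Fin (N + 1) → X D}
    {W : α → Fin (N + 1) → ℝ} {u : α → X D} (hx : Measurable x) (hz : Measurable z)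
    (hW : Measurable W) (hu : Measurable u) (hz' : Measurable z') :
    Measurable fun p => (K (x p) k' (z' p) (newWeights κ δ q (z p) a (u p) (z' p))).bind
      fun y => backStep κ δ q (u p) (W p) (z p) y :=
  measurable_bind_param (hK.measurable_newWeights hpos hcont k' a hx hz hu hz')
    (fun _ => hK.isProbabilityMeasure_newWeights hδ hpos _ _ _ _ _ _)
    (measurable_backStep hpos hcont (hu.comp measurable_fst) (hW.comp measurable_fst)
      (hz.comp measurable_fst) measurable_snd)

theorem IsContinuation.measurable_propagate (hK : IsContinuation K) (hδ : 0 < δ)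
    (hpos : ∀ x y, 0 < q x y) (hcont : Continuous (Function.uncurry q)) (k' : Fin (N + 1))
    (a : Fin (N + 1) → Fin (N + 1)) {x : α → Fin (r + 2) → X D} {z : α → Fin (N + 1) → X D}
    {W : α → Fin (N + 1) → ℝ} {u : α → X D} (hx : Measurable x) (hz : Measurable z)
    (hW : Measurable W) (hu : Measurable u) :
    Measurable fun p => (particles δ (u p) (x p 1) k').bind fun z' =>
      (K (Fin.tail (x p)) k' z' (newWeights κ δ q (z p) a (u p) z')).bind
        fun y => backStep κ δ q (u p) (W p) (z p) y :=
  measurable_bind_param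
    (measurable_particles hδ k' hu ((measurable_pi_apply 1).comp hx))
    (fun _ => isProbabilityMeasure_particles hδ _ _ _)
    (hK.measurable_select hδ hpos hcont k' a (measurable_fin_tail.comp (hx.comp measurable_fst))
      (hz.comp measurable_fst) (hW.comp measurable_fst) (hu.comp measurable_fst) measurable_snd)

theorem IsContinuation.measurable_extend (hK : IsContinuation K) (hδ : 0 < δ)
    (hpos : ∀ x y, 0 < q x y) (hcont : Continuous (Function.uncurry q)) (k : Fin (N + 1))
    {x : α → Fin (r + 2) → X D} {z : α → Fin (N + 1) → X D}
    {W : α → Fin (N + 1) → ℝ} (hx : Measurable x) (hz : Measurable z) (hW : Measurable W) :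
    Measurable fun p => extend κ δ q K (x p) k (z p) (W p) := by
  refine measurable_bind_finite (fun _ => measurable_const) fun k' =>
    measurable_bind_finite (fun a => (measurable_ancestors_singleton k k' a).comp hW) fun a => ?_
  have hm : Measurable fun p => gaussian (drift κ δ (q (x p 0)) (x p 1)) (δ / 2) :=
    (measurable_gaussian _ (half_pos hδ)).comp (measurable_drift κ δ hpos hcont
      ((measurable_pi_apply 0).comp hx) ((measurable_pi_apply 1).comp hx))
  exact measurable_bind_param hm (fun _ => isProbabilityMeasure_gaussian _ (half_pos hδ))
    (hK.measurable_propagate hδ hpos hcont k' a (hx.comp measurable_fst) (hz.comp measurable_fst)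
      (hW.comp measurable_fst) measurable_snd)

theorem isProbabilityMeasure_backStep (hδ : 0 < δ) (hpos : ∀ x y, 0 < q x y) (u : X D)
    {W : Fin (N + 1) → ℝ} (hW : ∀ i, 0 < W i) (z : Fin (N + 1) → X D) (y : Fin (r + 1) → X D) :
    IsProbabilityMeasure (backStep κ δ q u W z y) := by
  have := isProbabilityMeasure_backward κ hδ hpos u hW z (y 0)
  exact isProbabilityMeasure_bind Measurable.of_discrete fun _ => inferInstance

theorem IsContinuation.extend (hK : IsContinuation K) (hδ : 0 < δ)
    (hpos : ∀ x y, 0 < q x y) (hcont : Continuous (Function.uncurry q)) :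
    IsContinuation (extend κ δ q K) where
  measurable k := hK.measurable_extend hδ hpos hcont k measurable_fst
    (measurable_fst.comp measurable_snd) (measurable_snd.comp measurable_snd)
  isProbabilityMeasure x k z W hW h1 := by
    refine isProbabilityMeasure_bind Measurable.of_discrete fun k' => ?_
    have := isProbabilityMeasure_ancestors (fun i => (hW i).le) h1 k k'
    refine isProbabilityMeasure_bind Measurable.of_discrete fun a => ?_
    have := isProbabilityMeasure_gaussian (drift κ δ (q (x 0)) (x 1)) (half_pos hδ)
    refine isProbabilityMeasure_bind (hK.measurable_propagate hδ hpos hcont k' a measurable_const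
      measurable_const measurable_const measurable_id) fun u => ?_
    have := isProbabilityMeasure_particles hδ u (x 1) k'
    refine isProbabilityMeasure_bind (hK.measurable_select hδ hpos hcont k' a measurable_const
      measurable_const measurable_const measurable_const measurable_id) fun z' => ?_
    have := hK.isProbabilityMeasure_newWeights (κ := κ) hδ hpos (Fin.tail x) k' z a u z'
    exact isProbabilityMeasure_bind (measurable_backStep hpos hcont measurable_const
      measurable_const measurable_const measurable_id)
      fun y => isProbabilityMeasure_backStep hδ hpos u hW z y

theorem isContinuation_continueFrom (hN : 1 ≤ N) {κ : ℝ} :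
    ∀ {r : ℕ} {δ : Fin r → ℝ} {Q : Fin r → X D → X D → ℝ}, (∀ i, 0 < δ i) →
      (∀ i x y, 0 < Q i x y) → (∀ i, Continuous (Function.uncurry (Q i))) →
      IsContinuation (N := N) (continueFrom κ r δ Q)
  | 0, δ, Q, _, _, _ =>
    { measurable := fun k => measurable_bind_finite
        (m := fun p : (Fin 1 → X D) × (Fin (N + 1) → X D) × (Fin (N + 1) → ℝ) =>
          forcedMove p.2.2 k)
        (fun l => (Measure.measurable_coe (measurableSet_singleton l)).comp
          ((measurable_forcedMove k).comp (measurable_snd.comp measurable_snd)))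
        fun l => Measure.measurable_dirac.comp (measurable_pi_iff.2 fun _ =>
          (measurable_pi_apply l).comp (measurable_fst.comp measurable_snd))
      isProbabilityMeasure := fun x k z W hW h1 => by
        have := isProbabilityMeasure_forcedMove hN hW h1 k
        exact isProbabilityMeasure_bind Measurable.of_discrete fun _ => inferInstance }
  | _ + 1, _, _, hδ, hpos, hcont =>
    (isContinuation_continueFrom hN (fun i => hδ i.succ) (fun i => hpos i.succ)
      fun i => hcont i.succ).extend (hδ 0) (hpos 0) (hcont 0)

theorem lintegral_backStep (u : X D) (W : Fin (N + 1) → ℝ) (z : Fin (N + 1) → X D)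
    (y : Fin (r + 1) → X D) {f : (Fin (r + 2) → X D) → ENNReal} (hf : Measurable f) :
    ∫⁻ v, f v ∂backStep κ δ q u W z y =
      ∑ l, ENNReal.ofReal (normalize (fun i => W i * modifiedFactor κ δ (q (z i)) u (y 0)) l) *
        f (Fin.cons (z l) y) := by
  rw [backStep, Measure.lintegral_bind Measurable.of_discrete.aemeasurable hf.aemeasurable,
    backward, lintegral_discrete]
  simp only [lintegral_dirac' _ hf]

theorem IsContinuation.lintegral_extend (hK : IsContinuation K) (hδ : 0 < δ)
    (hpos : ∀ x y, 0 < q x y) (hcont : Continuous (Function.uncurry q))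
    (x : Fin (r + 2) → X D) (k : Fin (N + 1)) (z : Fin (N + 1) → X D) (W : Fin (N + 1) → ℝ)
    {f : (Fin (r + 2) → X D) → ENNReal} (hf : Measurable f) :
    ∫⁻ v, f v ∂ParticleAMALA.extend κ δ q K x k z W =
      ∫⁻ k', ∫⁻ a, ∫⁻ u, ∫⁻ z', ∫⁻ y, ∫⁻ v, f v
        ∂backStep κ δ q u W z y
        ∂K (Fin.tail x) k' z' (newWeights κ δ q z a u z')
        ∂particles δ u (x 1) k'
        ∂gaussian (drift κ δ (q (x 0)) (x 1)) (δ / 2)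
        ∂ancestors W k k' ∂uniformIndex N := by
  rw [ParticleAMALA.extend,
    Measure.lintegral_bind Measurable.of_discrete.aemeasurable hf.aemeasurable]
  refine lintegral_congr fun k' => ?_
  rw [Measure.lintegral_bind Measurable.of_discrete.aemeasurable hf.aemeasurable]
  refine lintegral_congr fun a => ?_
  refine (Measure.lintegral_bind (hK.measurable_propagate hδ hpos hcont k' a measurable_const
      measurable_const measurable_const measurable_id).aemeasurable hf.aemeasurable).trans ?_
  refine lintegral_congr fun u => ?_
  refine (Measure.lintegral_bind (hK.measurable_select hδ hpos hcont k' a measurable_const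
      measurable_const measurable_const measurable_const measurable_id).aemeasurable
      hf.aemeasurable).trans ?_
  refine lintegral_congr fun z' => ?_
  exact Measure.lintegral_bind (measurable_backStep hpos hcont measurable_const
    measurable_const measurable_const measurable_id).aemeasurable hf.aemeasurable

end Extend

/-! ### Invariance of one recursive call -/

section Invariance

variable {D N r : ℕ} {κ δ : ℝ} {q : X D → X D → ℝ}

attribute [local irreducible] gaussianDensity potential modifiedFactor drift

/-- Two disintegrations of the joint density of state and auxiliary variable: state first, or
auxiliary variable first. Both are `modifiedFactor`. -/
theorem ofReal_mul_gaussianDensity_drift (κ : ℝ) (hδ : 0 < δ) {q : X D → ℝ} (hpos : ∀ x, 0 < q x)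
    (u x : X D) :
    ENNReal.ofReal (q x) * ENNReal.ofReal (gaussianDensity (drift κ δ q x) (δ / 2) u) =
      ENNReal.ofReal (gaussianDensity u (δ / 2) x) * ENNReal.ofReal (potential κ δ q u x) := by
  rw [← ENNReal.ofReal_mul (hpos x).le, ← modifiedFactor_eq κ hδ, modifiedFactor,
    ENNReal.ofReal_mul (gaussianDensity_pos _ (half_pos hδ) _).le]

theorem measurable_lintegral_particles (hδ : 0 < δ) (k : Fin (N + 1)) {α : Type*}
    [MeasurableSpace α] {u x : α → X D} (hu : Measurable u) (hx : Measurable x)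
    {F : α → (Fin (N + 1) → X D) → ENNReal} (hF : Measurable (Function.uncurry F)) :
    Measurable fun a => ∫⁻ z, F a z ∂particles δ (u a) (x a) k :=
  measurable_lintegral_param (measurable_particles hδ k hu hx)
    (fun _ => isProbabilityMeasure_particles hδ _ _ _) hF

theorem lintegral_particles_gaussian (hδ : 0 < δ) (k : Fin (N + 1)) (u : X D)
    {F : X D → (Fin (N + 1) → X D) → ENNReal} (hF : Measurable (Function.uncurry F)) :
    ∫⁻ x, ∫⁻ z, F x z ∂particles δ u x k ∂gaussian u (δ / 2) =
      ∫⁻ z, F (z k) z ∂(Measure.pi fun _ : Fin (N + 1) => gaussian u (δ / 2)) := by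
  have := isProbabilityMeasure_gaussian u (half_pos hδ)
  exact lintegral_lintegral_pi_dirac k hF

/-- The reference state, the auxiliary variable and the particles, sampled in the order of the
algorithm, have the same law as in the order auxiliary variable, particles, reference index, up to
the weight of the reference particle. -/
theorem lintegral_forward (hδ : 0 < δ) (hpos : ∀ x y, 0 < q x y)
    (hcont : Continuous (Function.uncurry q)) (k : Fin (N + 1)) (x₀ : X D)
    {C : X D → (Fin (N + 1) → X D) → (Fin (r + 1) → X D) → ENNReal}
    (hC : Measurable fun p : X D × (Fin (N + 1) → X D) × (Fin (r + 1) → X D) =>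
      C p.1 p.2.1 p.2.2) :
    ∫⁻ x : Fin (r + 1) → X D, ENNReal.ofReal (q x₀ (x 0)) *
        ∫⁻ u, ∫⁻ z, C u z x ∂particles δ u (x 0) k ∂gaussian (drift κ δ (q x₀) (x 0)) (δ / 2) =
      ∫⁻ u, ∫⁻ z, (ENNReal.ofReal (potential κ δ (q x₀) u (z k)) *
        ∫⁻ x' : Fin r → X D, C u z (Fin.cons (z k) x'))
        ∂(Measure.pi fun _ : Fin (N + 1) => gaussian u (δ / 2)) := by
  have h0 : Measurable fun p : (Fin (r + 1) → X D) × X D => p.1 0 := by fun_prop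
  have hJ : Measurable fun p : (Fin (r + 1) → X D) × X D =>
      ∫⁻ z, C p.2 z p.1 ∂particles δ p.2 (p.1 0) k :=
    measurable_lintegral_particles hδ k measurable_snd h0
      (F := fun (p : (Fin (r + 1) → X D) × X D) (z : Fin (N + 1) → X D) => C p.2 z p.1)
      (hC.comp ((measurable_snd.comp measurable_fst).prodMk
        (measurable_snd.prodMk (measurable_fst.comp measurable_fst))))
  have hpot : Measurable fun p : X D × X D => ENNReal.ofReal (potential κ δ (q x₀) p.1 p.2) :=
    (measurable_potential κ δ hpos hcont measurable_const measurable_fst measurable_snd).ennreal_ofReal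
  have hM : Measurable fun p : (Fin (r + 1) → X D) × X D =>
      ENNReal.ofReal (gaussianDensity p.2 (δ / 2) (p.1 0)) *
        (ENNReal.ofReal (potential κ δ (q x₀) p.2 (p.1 0)) *
          ∫⁻ z, C p.2 z p.1 ∂particles δ p.2 (p.1 0) k) :=
    (measurable_gaussianDensity _ measurable_snd h0).ennreal_ofReal.mul
      ((hpot.comp (measurable_snd.prodMk h0)).mul hJ)
  calc _ = ∫⁻ x : Fin (r + 1) → X D, ∫⁻ u, ENNReal.ofReal (gaussianDensity u (δ / 2) (x 0)) *
        (ENNReal.ofReal (potential κ δ (q x₀) u (x 0)) *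
          ∫⁻ z, C u z x ∂particles δ u (x 0) k) := by
        refine lintegral_congr fun x => ?_
        have hJx : Measurable fun u => ∫⁻ z, C u z x ∂particles δ u (x 0) k :=
          measurable_lintegral_particles hδ k measurable_id measurable_const
            (F := fun u (z : Fin (N + 1) → X D) => C u z x)
            (hC.comp (measurable_fst.prodMk (measurable_snd.prodMk measurable_const)))
        rw [lintegral_gaussian _ _ hJx, ← lintegral_const_mul' _ _ ENNReal.ofReal_ne_top]
        refine lintegral_congr fun u => ?_
        rw [← mul_assoc, ofReal_mul_gaussianDensity_drift κ hδ (hpos x₀), mul_assoc]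
    -- Now `u` comes first and carries Lebesgue measure, which is not normalised; Tonelli does not
    -- mind.
    _ = ∫⁻ u, ∫⁻ x : Fin (r + 1) → X D, ENNReal.ofReal (gaussianDensity u (δ / 2) (x 0)) *
        (ENNReal.ofReal (potential κ δ (q x₀) u (x 0)) *
          ∫⁻ z, C u z x ∂particles δ u (x 0) k) := lintegral_lintegral_swap hM.aemeasurable
    _ = _ := by
        refine lintegral_congr fun u => ?_
        have hCu : Measurable fun p : X D × (Fin (N + 1) → X D) × (Fin r → X D) =>
            C u p.2.1 (Fin.cons p.1 p.2.2) :=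
          hC.comp (measurable_const.prodMk ((measurable_fst.comp measurable_snd).prodMk
            (measurable_fin_cons.comp (measurable_fst.prodMk
              (measurable_snd.comp measurable_snd)))))
        have hI : Measurable fun p : X D × (Fin (N + 1) → X D) =>
            ∫⁻ x' : Fin r → X D, C u p.2 (Fin.cons p.1 x') :=
          Measurable.lintegral_prod_right' (f := fun p : (X D × (Fin (N + 1) → X D)) ×
            (Fin r → X D) => C u p.1.2 (Fin.cons p.1.1 p.2))
            (hCu.comp (((measurable_fst.comp measurable_fst)).prodMk
              ((measurable_snd.comp measurable_fst).prodMk measurable_snd)))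
        have hpu : Measurable fun x => ENNReal.ofReal (potential κ δ (q x₀) u x) :=
          hpot.comp measurable_prodMk_left
        have hF : Measurable (Function.uncurry fun (x : X D) (z : Fin (N + 1) → X D) =>
            ENNReal.ofReal (potential κ δ (q x₀) u x) *
              ∫⁻ x' : Fin r → X D, C u z (Fin.cons x x')) := (hpu.comp measurable_fst).mul hI
        have hL : Measurable fun x => ∫⁻ z, ENNReal.ofReal (potential κ δ (q x₀) u x) *
              (∫⁻ x' : Fin r → X D, C u z (Fin.cons x x')) ∂particles δ u x k :=
          measurable_lintegral_particles hδ k measurable_const measurable_id hF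
        -- The planted state now has law `N(u)`, so the independent particles on the right can be
        -- traded for a reference state followed by the others.
        rw [← lintegral_particles_gaussian hδ k u hF, lintegral_gaussian _ _ hL,
          lintegral_fin_cons (F := fun x => ENNReal.ofReal (gaussianDensity u (δ / 2) (x 0)) *
            (ENNReal.ofReal (potential κ δ (q x₀) u (x 0)) *
              ∫⁻ z, C u z x ∂particles δ u (x 0) k)) (hM.comp measurable_prodMk_right)]
        refine lintegral_congr fun x => ?_
        have := isProbabilityMeasure_particles hδ u x k
        have hK : Measurable fun p : (Fin r → X D) × (Fin (N + 1) → X D) =>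
            C u p.2 (Fin.cons x p.1) :=
          hCu.comp (measurable_const.prodMk (measurable_snd.prodMk measurable_fst))
        simp only [Fin.cons_zero]
        rw [lintegral_const_mul' _ _ ENNReal.ofReal_ne_top,
          lintegral_const_mul' _ _ ENNReal.ofReal_ne_top,
          lintegral_const_mul' _ _ ENNReal.ofReal_ne_top,
          lintegral_lintegral_swap hK.aemeasurable]

/-- The reference index at the earlier time has law `W` and is planted as the ancestor of `k'`, so
the ancestors become independent and that index is read off as `a k'`. -/
theorem sum_lintegral_ancestors {W : Fin (N + 1) → ℝ} (h0 : ∀ i, 0 ≤ W i)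
    (h1 : ∑ i, W i = 1) (k' : Fin (N + 1))
    (H : Fin (N + 1) → (Fin (N + 1) → Fin (N + 1)) → ENNReal) :
    ∑ k, ENNReal.ofReal (W k) * ∫⁻ a, H k a ∂ancestors W k k' =
      ∫⁻ a, H (a k') a ∂(Measure.pi fun _ : Fin (N + 1) => discrete W) := by
  have := isProbabilityMeasure_discrete h0 h1
  rw [← lintegral_discrete]
  exact lintegral_lintegral_pi_dirac k' Measurable.of_discrete

theorem measurable_pi_gaussian {v : ℝ} (hv : 0 < v) :
    Measurable fun u : X D => Measure.pi fun _ : Fin (N + 1) => gaussian u v := by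
  have := isProbabilityMeasure_gaussian (0 : X D) hv
  have h : ∀ u : X D, (Measure.pi fun _ : Fin (N + 1) => gaussian u v) =
      (Measure.pi fun _ : Fin (N + 1) => gaussian (0 : X D) v).map fun z n => u + z n := fun u => by
    have := Measure.isProbabilityMeasure_map (μ := gaussian (0 : X D) v)
      (measurable_const_add u).aemeasurable
    rw [Measure.pi_map_pi (f := fun (_ : Fin (N + 1)) (y : X D) => u + y)
      fun _ => (measurable_const_add u).aemeasurable]
    congr 1
    funext n
    exact gaussian_eq_map u v
  rw [funext h]
  exact measurable_map_param (φ := fun (u : X D) (z : Fin (N + 1) → X D) n => u + z n)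
    (measurable_pi_iff.2 fun n => measurable_fst.add ((measurable_pi_apply n).comp measurable_snd))

/-- Summation over the new reference index inside the integrals over the other variables. -/
theorem sum_lintegral_lintegral_pi {α : Type*} [MeasurableSpace α] [DiscreteMeasurableSpace α]
    (ν : Measure α) {v : ℝ} (hv : 0 < v)
    {V : Fin (N + 1) → α → X D → (Fin (N + 1) → X D) → ENNReal}
    (hV : ∀ k a, Measurable fun p : X D × (Fin (N + 1) → X D) => V k a p.1 p.2) :
    ∑ k, ∫⁻ a, ∫⁻ u, ∫⁻ z, V k a u z
        ∂(Measure.pi fun _ : Fin (N + 1) => gaussian u v) ∂volume ∂ν =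
      ∫⁻ a, ∫⁻ u, ∫⁻ z, ∑ k, V k a u z
        ∂(Measure.pi fun _ : Fin (N + 1) => gaussian u v) ∂volume ∂ν := by
  rw [← lintegral_finsetSum _ fun k _ => Measurable.of_discrete]
  refine lintegral_congr fun a => ?_
  rw [← lintegral_finsetSum _ fun k _ => measurable_lintegral_param (measurable_pi_gaussian hv)
    (fun u => by have := isProbabilityMeasure_gaussian u hv; infer_instance) (hV k a)]
  refine lintegral_congr fun u => ?_
  exact (lintegral_finsetSum _ fun k _ => (hV k a).comp measurable_prodMk_left).symm

/-- `K` leaves the law with density proportional to `ρ` invariant, conditionally on the particles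
and weights at the first time point. -/
def Preserves (K : (Fin (r + 1) → X D) → Fin (N + 1) → (Fin (N + 1) → X D) →
    (Fin (N + 1) → ℝ) → Measure (Fin (r + 1) → X D)) (ρ : (Fin (r + 1) → X D) → ENNReal) : Prop :=
  ∀ (z : Fin (N + 1) → X D) (w : Fin (N + 1) → ℝ), (∀ i, 0 < w i) →
    ∀ f : (Fin (r + 1) → X D) → ENNReal, Measurable f →
    ∑ k, ENNReal.ofReal (w k) * ∫⁻ x' : Fin r → X D, ρ (Fin.cons (z k) x') *
        ∫⁻ y, f y ∂K (Fin.cons (z k) x') k z (normalize w) =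
      ∑ k, ENNReal.ofReal (w k) * ∫⁻ x' : Fin r → X D, ρ (Fin.cons (z k) x') *
        f (Fin.cons (z k) x')

theorem normalize_eq_self {w : Fin (N + 1) → ℝ} (h : ∑ i, w i = 1) : normalize w = w := by
  funext i
  simp [normalize, h]

/-- It suffices to consider normalised weights. -/
theorem preserves_of_normalized {K : (Fin (r + 1) → X D) → Fin (N + 1) → (Fin (N + 1) → X D) →
    (Fin (N + 1) → ℝ) → Measure (Fin (r + 1) → X D)} {ρ : (Fin (r + 1) → X D) → ENNReal}
    (h : ∀ (z : Fin (N + 1) → X D) (W : Fin (N + 1) → ℝ), (∀ i, 0 < W i) → ∑ i, W i = 1 →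
      ∀ f : (Fin (r + 1) → X D) → ENNReal, Measurable f →
      ∑ k, ENNReal.ofReal (W k) * ∫⁻ x' : Fin r → X D, ρ (Fin.cons (z k) x') *
          ∫⁻ y, f y ∂K (Fin.cons (z k) x') k z W =
        ∑ k, ENNReal.ofReal (W k) * ∫⁻ x' : Fin r → X D, ρ (Fin.cons (z k) x') *
          f (Fin.cons (z k) x')) : Preserves K ρ := by
  intro z w hw f hf
  have hs := sum_pos_of_pos hw
  -- Both sides are homogeneous in `w`, while `K` sees only the normalised weights.
  have hk : ∀ k, ENNReal.ofReal (w k) =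
      ENNReal.ofReal (∑ i, w i) * ENNReal.ofReal (normalize w k) := fun k => by
    rw [← ENNReal.ofReal_mul hs.le, normalize, mul_div_cancel₀ _ hs.ne']
  simp only [hk, mul_assoc, ← Finset.mul_sum]
  rw [h z (normalize w) (normalize_pos hw) (sum_normalize hw) f hf]

/-- Backward sampling cancels against the sum over the ancestors of the selected state. -/
theorem sum_lintegral_backward (hδ : 0 < δ) (hpos : ∀ x y, 0 < q x y)
    (hcont : Continuous (Function.uncurry q)) {ρ : (Fin (r + 1) → X D) → ENNReal}
    (hρ : Measurable ρ) (z : Fin (N + 1) → X D) {W : Fin (N + 1) → ℝ} (hW : ∀ i, 0 < W i)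
    {f : (Fin (r + 2) → X D) → ENNReal} (hf : Measurable f) :
    ∑ k, ENNReal.ofReal (W k) * ∫⁻ u, ∫⁻ x₁, ENNReal.ofReal (potential κ δ (q (z k)) u x₁) *
        (∫⁻ x' : Fin r → X D, ρ (Fin.cons x₁ x') *
          ∫⁻ v, f v ∂backStep κ δ q u W z (Fin.cons x₁ x')) ∂gaussian u (δ / 2) =
      ∑ k, ENNReal.ofReal (W k) * ∫⁻ x : Fin (r + 1) → X D,
        ENNReal.ofReal (q (z k) (x 0)) * ρ x * f (Fin.cons (z k) x) := by
  set m : Fin (N + 1) → X D → X D → ℝ := fun l u x₁ => modifiedFactor κ δ (q (z l)) u x₁ with hm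
  set ψ : Fin (N + 1) → X D → ENNReal := fun l x₁ => ∫⁻ x' : Fin r → X D,
    ρ (Fin.cons x₁ x') * f (Fin.cons (z l) (Fin.cons x₁ x')) with hψ
  set B : X D → X D → ENNReal := fun u x₁ => ∫⁻ x' : Fin r → X D, ρ (Fin.cons x₁ x') *
    ∫⁻ v, f v ∂backStep κ δ q u W z (Fin.cons x₁ x') with hB
  have hm0 : ∀ l u x₁, 0 < W l * m l u x₁ := fun l u x₁ =>
    mul_pos (hW l) (modifiedFactor_pos κ hδ (hpos _) u x₁)
  have hmm : ∀ l, Measurable fun p : X D × X D => W l * m l p.1 p.2 := fun l =>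
    (measurable_modifiedFactor κ δ hpos hcont measurable_const measurable_fst
      measurable_snd).const_mul (W l)
  have hψi : ∀ l, Measurable fun p : X D × (Fin r → X D) =>
      ρ (Fin.cons p.1 p.2) * f (Fin.cons (z l) (Fin.cons p.1 p.2)) := fun l =>
    (hρ.comp measurable_fin_cons).mul
      (hf.comp (measurable_fin_cons.comp (measurable_const.prodMk measurable_fin_cons)))
  have hψm : ∀ l, Measurable (ψ l) := fun l => (hψi l).lintegral_prod_right'
  -- The backward probabilities depend on the selected path only through its first state `x₁`, so
  -- they leave the integral over `x'`.
  have hBψ : ∀ u x₁, B u x₁ =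
      ∑ l, ENNReal.ofReal (normalize (fun i => W i * m i u x₁) l) * ψ l x₁ := fun u x₁ => by
    simp only [hB, hψ, lintegral_backStep _ _ _ _ hf, Finset.mul_sum, Fin.cons_zero]
    rw [lintegral_finsetSum]
    · refine Finset.sum_congr rfl fun l _ => ?_
      rw [← lintegral_const_mul' _ _ ENNReal.ofReal_ne_top]
      refine lintegral_congr fun x' => ?_
      ring
    · intro l _
      have hc : Measurable fun x' : Fin r → X D => (Fin.cons x₁ x' : Fin (r + 1) → X D) :=
        measurable_fin_cons.comp measurable_prodMk_left
      exact (hρ.comp hc).mul ((hf.comp (measurable_fin_cons.comp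
        (measurable_const.prodMk hc))).const_mul _)
  have hBm : Measurable fun p : X D × X D => B p.1 p.2 := by
    simp only [hBψ]
    refine Finset.measurable_sum _ fun l _ => ?_
    exact ((measurable_pi_apply l).comp (measurable_normalize
      (measurable_pi_iff.2 hmm))).ennreal_ofReal.mul ((hψm l).comp measurable_snd)
  -- `B` does not depend on `k`, and the sum of its coefficients is exactly the denominator in
  -- `normalize`.
  have hBcancel : ∀ u x₁, ∑ k, ENNReal.ofReal (W k * m k u x₁) * B u x₁ =
      ∑ l, ENNReal.ofReal (W l * m l u x₁) * ψ l x₁ := fun u x₁ => by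
    have hs := sum_pos_of_pos fun i => hm0 i u x₁
    rw [← Finset.sum_mul, ← ENNReal.ofReal_sum_of_nonneg fun i _ => (hm0 i u x₁).le, hBψ,
      Finset.mul_sum]
    refine Finset.sum_congr rfl fun l _ => ?_
    rw [← mul_assoc, ← ENNReal.ofReal_mul hs.le, normalize, mul_div_cancel₀ _ hs.ne']
  have hterm : ∀ {G : Fin (N + 1) → X D → X D → ENNReal},
      (∀ k, Measurable fun p : X D × X D => G k p.1 p.2) →
      ∑ k, ∫⁻ u, ∫⁻ x₁, ENNReal.ofReal (W k * m k u x₁) * G k u x₁ =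
        ∫⁻ u, ∫⁻ x₁, ∑ k, ENNReal.ofReal (W k * m k u x₁) * G k u x₁ := fun {G} hG => by
    have hi : ∀ k, Measurable fun p : X D × X D =>
        ENNReal.ofReal (W k * m k p.1 p.2) * G k p.1 p.2 := fun k =>
      (hmm k).ennreal_ofReal.mul (hG k)
    rw [← lintegral_finsetSum _ fun k _ => (hi k).lintegral_prod_right']
    refine lintegral_congr fun u => ?_
    exact (lintegral_finsetSum _ fun k _ => (hi k).comp measurable_prodMk_left).symm
  calc _ = ∑ k, ∫⁻ u, ∫⁻ x₁, ENNReal.ofReal (W k * m k u x₁) * B u x₁ := by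
        refine Finset.sum_congr rfl fun k _ => ?_
        rw [← lintegral_const_mul' _ _ ENNReal.ofReal_ne_top]
        refine lintegral_congr fun u => ?_
        have hp : Measurable fun x₁ => ENNReal.ofReal (potential κ δ (q (z k)) u x₁) * B u x₁ :=
          (measurable_potential κ δ hpos hcont measurable_const measurable_const
            measurable_id).ennreal_ofReal.mul (hBm.comp measurable_prodMk_left)
        rw [lintegral_gaussian _ _ hp, ← lintegral_const_mul' _ _ ENNReal.ofReal_ne_top]
        refine lintegral_congr fun x₁ => ?_
        rw [hm, ENNReal.ofReal_mul (hW k).le]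
        simp only [modifiedFactor]
        rw [ENNReal.ofReal_mul (gaussianDensity_pos _ (half_pos hδ) _).le]
        ring
    _ = ∫⁻ u, ∫⁻ x₁, ∑ l, ENNReal.ofReal (W l * m l u x₁) * ψ l x₁ := by
        rw [hterm fun _ => hBm]
        simp only [hBcancel]
    _ = ∑ l, ∫⁻ u, ∫⁻ x₁, ENNReal.ofReal (W l * m l u x₁) * ψ l x₁ :=
        (hterm (G := fun l _ x₁ => ψ l x₁) fun l => (hψm l).comp measurable_snd).symm
    _ = _ := by
        refine Finset.sum_congr rfl fun l _ => ?_
        have hi : Measurable fun p : X D × X D => ENNReal.ofReal (W l * m l p.1 p.2) * ψ l p.2 :=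
          (hmm l).ennreal_ofReal.mul ((hψm l).comp measurable_snd)
        have hq : Measurable fun x => ENNReal.ofReal (q (z l) x) :=
          (hcont.measurable.comp measurable_prodMk_left).ennreal_ofReal
        have hx : Measurable fun x : Fin (r + 1) → X D =>
            ENNReal.ofReal (q (z l) (x 0)) * ρ x * f (Fin.cons (z l) x) :=
          ((hq.comp (measurable_pi_apply 0)).mul hρ).mul
            (hf.comp (measurable_fin_cons.comp measurable_prodMk_left))
        -- `ψ l` does not involve `u`, so `u` is integrated first; by `modifiedFactor_eq` it
        -- integrates a Gaussian density.
        rw [lintegral_lintegral_swap hi.aemeasurable, lintegral_fin_cons hx,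
          ← lintegral_const_mul' _ _ ENNReal.ofReal_ne_top]
        refine lintegral_congr fun x₁ => ?_
        have hg : Measurable fun u => ENNReal.ofReal (W l * m l u x₁) :=
          (hmm l).ennreal_ofReal.comp measurable_prodMk_right
        simp only [Fin.cons_zero, mul_assoc]
        rw [lintegral_mul_const _ hg, lintegral_const_mul' _ _ ENNReal.ofReal_ne_top, ← mul_assoc]
        congr 1
        simp only [hm, modifiedFactor_eq κ hδ, ENNReal.ofReal_mul (hW l).le,
          ENNReal.ofReal_mul (hpos _ _).le]
        rw [lintegral_const_mul' _ _ ENNReal.ofReal_ne_top,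
          lintegral_const_mul' _ _ ENNReal.ofReal_ne_top,
          lintegral_gaussianDensity_left _ (half_pos hδ), mul_one]

end Invariance

/-! ### Invariance of the recursive part of the algorithm -/

section Algorithm

attribute [local irreducible] gaussianDensity potential modifiedFactor drift

variable {D N r : ℕ} {κ δ : ℝ} {q : X D → X D → ℝ}
  {K : (Fin (r + 1) → X D) → Fin (N + 1) → (Fin (N + 1) → X D) → (Fin (N + 1) → ℝ) →
    Measure (Fin (r + 1) → X D)} {ρ : (Fin (r + 1) → X D) → ENNReal}

theorem measurable_lintegral_backStep (hpos : ∀ x y, 0 < q x y)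
    (hcont : Continuous (Function.uncurry q)) (W : Fin (N + 1) → ℝ) (z : Fin (N + 1) → X D)
    {f : (Fin (r + 2) → X D) → ENNReal} (hf : Measurable f) :
    Measurable fun p : X D × (Fin (r + 1) → X D) => ∫⁻ v, f v ∂backStep κ δ q p.1 W z p.2 :=
  (Measure.measurable_lintegral hf).comp
    (measurable_backStep hpos hcont measurable_fst measurable_const measurable_const measurable_snd)

theorem IsContinuation.measurable_lintegral_select (hK : IsContinuation K) (hδ : 0 < δ)
    (hpos : ∀ x y, 0 < q x y) (hcont : Continuous (Function.uncurry q)) (hρ : Measurable ρ)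
    (z : Fin (N + 1) → X D) (k' : Fin (N + 1)) (a : Fin (N + 1) → Fin (N + 1))
    {Φ : X D → (Fin (r + 1) → X D) → ENNReal} (hΦ : Measurable (Function.uncurry Φ)) :
    Measurable fun p : X D × (Fin (N + 1) → X D) × (Fin (r + 1) → X D) =>
      ρ p.2.2 * ∫⁻ y, Φ p.1 y ∂K p.2.2 k' p.2.1 (newWeights κ δ q z a p.1 p.2.1) := by
  refine (hρ.comp (measurable_snd.comp measurable_snd)).mul ?_
  refine measurable_lintegral_param (m := fun p : X D × (Fin (N + 1) → X D) ×
    (Fin (r + 1) → X D) => K p.2.2 k' p.2.1 (newWeights κ δ q z a p.1 p.2.1))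
    (f := fun p y => Φ p.1 y) ?_ ?_ ?_
  · exact hK.measurable_newWeights hpos hcont k' a (measurable_snd.comp measurable_snd)
      measurable_const measurable_fst (measurable_fst.comp measurable_snd)
  · exact fun _ => hK.isProbabilityMeasure_newWeights hδ hpos _ _ _ _ _ _
  · exact hΦ.comp ((measurable_fst.comp measurable_fst).prodMk measurable_snd)

/-- One recursive call, integrated over the reference path after the current time point. -/
theorem IsContinuation.lintegral_reference (hK : IsContinuation K) (hδ : 0 < δ)
    (hpos : ∀ x y, 0 < q x y) (hcont : Continuous (Function.uncurry q)) (hρ : Measurable ρ)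
    (hρ_top : ∀ x, ρ x ≠ ⊤) (k : Fin (N + 1)) (z : Fin (N + 1) → X D) {W : Fin (N + 1) → ℝ}
    (hW : ∀ i, 0 < W i) (h1 : ∑ i, W i = 1) {f : (Fin (r + 2) → X D) → ENNReal}
    (hf : Measurable f) :
    ∫⁻ x : Fin (r + 1) → X D, ENNReal.ofReal (q (z k) (x 0)) * ρ x *
        ∫⁻ v, f v ∂ParticleAMALA.extend κ δ q K (Fin.cons (z k) x) k z W =
      ∫⁻ k', ∫⁻ a, ∫⁻ u, ∫⁻ z', (ENNReal.ofReal (potential κ δ (q (z k)) u (z' k')) *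
        ∫⁻ x' : Fin r → X D, ρ (Fin.cons (z' k') x') *
          ∫⁻ y, ∫⁻ v, f v ∂backStep κ δ q u W z y
            ∂K (Fin.cons (z' k') x') k' z' (newWeights κ δ q z a u z'))
        ∂(Measure.pi fun _ : Fin (N + 1) => gaussian u (δ / 2))
        ∂volume ∂ancestors W k k' ∂uniformIndex N := by
  have hΦ := measurable_lintegral_backStep (κ := κ) (δ := δ) hpos hcont W z hf
  have hanc := isProbabilityMeasure_ancestors (fun i => (hW i).le) h1 k
  have hC := fun k' a => hK.measurable_lintegral_select (κ := κ) hδ hpos hcont hρ z k' a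
    (Φ := fun u y => ∫⁻ v, f v ∂backStep κ δ q u W z y) hΦ
  set C : Fin (N + 1) → (Fin (N + 1) → Fin (N + 1)) → X D → (Fin (N + 1) → X D) →
    (Fin (r + 1) → X D) → ENNReal := fun k' a u z' x =>
      ρ x * ∫⁻ y, ∫⁻ v, f v ∂backStep κ δ q u W z y ∂K x k' z' (newWeights κ δ q z a u z') with hCdef
  have h0 : Measurable fun x : Fin (r + 1) → X D => x 0 := by fun_prop
  have hJ : ∀ k' a, Measurable fun x : Fin (r + 1) → X D => ENNReal.ofReal (q (z k) (x 0)) *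
      ∫⁻ u, ∫⁻ z', C k' a u z' x ∂particles δ u (x 0) k'
        ∂gaussian (drift κ δ (q (z k)) (x 0)) (δ / 2) := fun k' a => by
    refine Measurable.mul (hcont.measurable.comp (measurable_const.prodMk h0)).ennreal_ofReal ?_
    refine measurable_lintegral_param (m := fun x : Fin (r + 1) → X D =>
      gaussian (drift κ δ (q (z k)) (x 0)) (δ / 2)) ?_
      (fun _ => isProbabilityMeasure_gaussian _ (half_pos hδ)) ?_
    · exact (measurable_gaussian _ (half_pos hδ)).comp
        (measurable_drift κ δ hpos hcont measurable_const h0)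
    · exact measurable_lintegral_particles hδ k' measurable_snd (h0.comp measurable_fst)
        (F := fun (p : (Fin (r + 1) → X D) × X D) (z' : Fin (N + 1) → X D) => C k' a p.2 z' p.1)
        ((hC k' a).comp ((measurable_snd.comp measurable_fst).prodMk
          (measurable_snd.prodMk (measurable_fst.comp measurable_fst))))
  have hρC : ∀ x : Fin (r + 1) → X D, ENNReal.ofReal (q (z k) (x 0)) * ρ x *
      ∫⁻ v, f v ∂ParticleAMALA.extend κ δ q K (Fin.cons (z k) x) k z W =
      ∫⁻ k', ∫⁻ a, ENNReal.ofReal (q (z k) (x 0)) * ∫⁻ u, ∫⁻ z', C k' a u z' x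
        ∂particles δ u (x 0) k' ∂gaussian (drift κ δ (q (z k)) (x 0)) (δ / 2)
        ∂ancestors W k k' ∂uniformIndex N := fun x => by
    have hx1 : (Fin.cons (z k) x : Fin (r + 2) → X D) 1 = x 0 := rfl
    -- Finiteness of `ρ x` lets it pass under each integral without measurability of the integrand.
    rw [hK.lintegral_extend hδ hpos hcont _ k z W hf, mul_assoc,
      ← lintegral_const_mul' _ _ (hρ_top x), ← lintegral_const_mul' _ _ ENNReal.ofReal_ne_top]
    refine lintegral_congr fun k' => ?_
    rw [← lintegral_const_mul' _ _ (hρ_top x), ← lintegral_const_mul' _ _ ENNReal.ofReal_ne_top]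
    refine lintegral_congr fun a => ?_
    rw [hx1, Fin.cons_zero, Fin.tail_cons, ← lintegral_const_mul' _ _ (hρ_top x)]
    congr 1
    refine lintegral_congr fun u => ?_
    rw [← lintegral_const_mul' _ _ (hρ_top x)]
  -- The integrals over indices become finite sums, so the integral over `x` can be taken term by
  -- term.
  simp only [hρC, lintegral_fintype]
  rw [lintegral_finsetSum _ fun k' _ =>
    (Finset.measurable_sum _ fun a _ => (hJ k' a).mul_const _).mul_const _]
  refine Finset.sum_congr rfl fun k' _ => ?_
  rw [lintegral_mul_const' _ _ (measure_ne_top _ _), lintegral_finsetSum _ fun a _ =>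
    (hJ k' a).mul_const _]
  congr 1
  refine Finset.sum_congr rfl fun a _ => ?_
  have := hanc k'
  rw [lintegral_mul_const' _ _ (measure_ne_top _ _),
    lintegral_forward hδ hpos hcont k' (z k) (hC k' a)]

theorem sum_uniform_mul (c : ENNReal) :
    ∑ _i : Fin (N + 1), ENNReal.ofReal (1 / ((N : ℝ) + 1)) * c = c := by
  rw [← Finset.sum_mul, ← ENNReal.ofReal_sum_of_nonneg fun _ _ => by positivity]
  have : (N : ℝ) + 1 ≠ 0 := by positivity
  simp [this]

/-- The inductive step: reverse the order of sampling, apply the hypothesis at the next time point,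
discard the particles that are no longer referred to, and let backward sampling cancel. -/
theorem Preserves.extend (hP : Preserves K ρ) (hK : IsContinuation K) (hδ : 0 < δ)
    (hpos : ∀ x y, 0 < q x y) (hcont : Continuous (Function.uncurry q)) (hρ : Measurable ρ)
    (hρ_top : ∀ x, ρ x ≠ ⊤) :
    Preserves (extend κ δ q K)
      fun x : Fin (r + 2) → X D => ENNReal.ofReal (q (x 0) (x 1)) * ρ (Fin.tail x) := by
  refine preserves_of_normalized fun z W hW h1 f hf => ?_
  have hΦ := measurable_lintegral_backStep (κ := κ) (δ := δ) hpos hcont W z hf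
  have hC := fun k' a => hK.measurable_lintegral_select (κ := κ) hδ hpos hcont hρ z k' a
    (Φ := fun u y => ∫⁻ v, f v ∂backStep κ δ q u W z y) hΦ
  have hx1 : ∀ (x₀ : X D) (x : Fin (r + 1) → X D), (Fin.cons x₀ x : Fin (r + 2) → X D) 1 = x 0 :=
    fun _ _ => rfl
  have hcons : ∀ k' : Fin (N + 1), Measurable
      fun p : (X D × (Fin (N + 1) → X D)) × (Fin r → X D) =>
        (Fin.cons (p.1.2 k') p.2 : Fin (r + 1) → X D) := fun k' =>
    measurable_fin_cons.comp (f := fun p : (X D × (Fin (N + 1) → X D)) × (Fin r → X D) =>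
      (p.1.2 k', p.2)) (by fun_prop)
  have hpot : ∀ (k' : Fin (N + 1)) (a : Fin (N + 1) → Fin (N + 1)), Measurable
      fun p : X D × (Fin (N + 1) → X D) =>
        ENNReal.ofReal (potential κ δ (q (z (a k'))) p.1 (p.2 k')) := fun k' a =>
    (measurable_potential κ δ hpos hcont measurable_const measurable_fst
      ((measurable_pi_apply k').comp measurable_snd)).ennreal_ofReal
  set G : Fin (N + 1) → (Fin (N + 1) → Fin (N + 1)) → X D → (Fin (N + 1) → X D) → ENNReal :=
    fun k' a u z' => ENNReal.ofReal (potential κ δ (q (z (a k'))) u (z' k')) with hG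
  set V : Fin (N + 1) → (Fin (N + 1) → Fin (N + 1)) → X D → (Fin (N + 1) → X D) → ENNReal :=
    fun k' a u z' => G k' a u z' *
      ∫⁻ x' : Fin r → X D, ρ (Fin.cons (z' k') x') * ∫⁻ y, ∫⁻ v, f v ∂backStep κ δ q u W z y
        ∂K (Fin.cons (z' k') x') k' z' (newWeights κ δ q z a u z') with hV
  set Ψ : X D → X D → ENNReal := fun u x₁ => ∫⁻ x' : Fin r → X D, ρ (Fin.cons x₁ x') *
      ∫⁻ v, f v ∂backStep κ δ q u W z (Fin.cons x₁ x') with hΨ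
  have hVm : ∀ k' a, Measurable fun p : X D × (Fin (N + 1) → X D) => V k' a p.1 p.2 :=
    fun k' a => (hpot k' a).mul (Measurable.lintegral_prod_right'
      ((hC k' a).comp ((measurable_fst.comp measurable_fst).prodMk
        ((measurable_snd.comp measurable_fst).prodMk (hcons k')))))
  have hΨm : Measurable fun p : X D × X D => Ψ p.1 p.2 := by
    have hc : Measurable fun p : (X D × X D) × (Fin r → X D) =>
        (Fin.cons p.1.2 p.2 : Fin (r + 1) → X D) :=
      measurable_fin_cons.comp ((measurable_snd.comp measurable_fst).prodMk measurable_snd)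
    exact Measurable.lintegral_prod_right' ((hρ.comp hc).mul
      (hΦ.comp ((measurable_fst.comp measurable_fst).prodMk hc)))
  have hVm' : ∀ k' a, Measurable fun p : X D × (Fin (N + 1) → X D) =>
      G k' a p.1 p.2 * Ψ p.1 (p.2 k') := fun k' a =>
    (hpot k' a).mul (hΨm.comp (measurable_fst.prodMk
      ((measurable_pi_apply k').comp measurable_snd)))
  -- The hypothesis is used with the unnormalised potentials as weights and with the expected result
  -- of the backward step as test function.
  have hIH : ∀ a u z', ∑ k', V k' a u z' = ∑ k', G k' a u z' * Ψ u (z' k') := fun a u z' =>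
    hP z' (fun n => potential κ δ (q (z (a n))) u (z' n))
      (fun n => potential_pos κ hδ (hpos _) u (z' n)) _ ((Measure.measurable_lintegral hf).comp
        (measurable_backStep hpos hcont measurable_const measurable_const measurable_const
          measurable_id))
  have hprob := isProbabilityMeasure_discrete (fun i => (hW i).le) h1
  -- Only `a k'` and `z' k'` still occur, with laws `W` and `N(u)`; the other coordinates integrate
  -- to one and the value no longer depends on `k'`.
  have hterm : ∀ k' : Fin (N + 1), ∫⁻ a, ∫⁻ u, ∫⁻ z', G k' a u z' * Ψ u (z' k')
        ∂(Measure.pi fun _ : Fin (N + 1) => gaussian u (δ / 2)) ∂volume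
        ∂(Measure.pi fun _ : Fin (N + 1) => discrete W) =
      ∑ k, ENNReal.ofReal (W k) * ∫⁻ u, ∫⁻ x₁, ENNReal.ofReal (potential κ δ (q (z k)) u x₁) *
        Ψ u x₁ ∂gaussian u (δ / 2) := fun k' => by
    rw [← lintegral_discrete]
    refine Eq.trans ?_ (lintegral_pi_eval k' (F := fun k => ∫⁻ u, ∫⁻ x₁,
      ENNReal.ofReal (potential κ δ (q (z k)) u x₁) * Ψ u x₁ ∂gaussian u (δ / 2))
      Measurable.of_discrete)
    refine lintegral_congr fun a => lintegral_congr fun u => ?_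
    have := isProbabilityMeasure_gaussian u (half_pos hδ)
    refine lintegral_pi_eval k' (F := fun x₁ =>
      ENNReal.ofReal (potential κ δ (q (z (a k'))) u x₁) * Ψ u x₁) ?_
    exact (measurable_potential κ δ hpos hcont measurable_const measurable_const
      measurable_id).ennreal_ofReal.mul (hΨm.comp measurable_prodMk_left)
  simp only [Fin.cons_zero, hx1, Fin.tail_cons]
  calc _ = ∑ k, ENNReal.ofReal (W k) * ∑ k', ENNReal.ofReal (1 / ((N : ℝ) + 1)) *
        ∫⁻ a, ∫⁻ u, ∫⁻ z', (ENNReal.ofReal (potential κ δ (q (z k)) u (z' k')) *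
          ∫⁻ x' : Fin r → X D, ρ (Fin.cons (z' k') x') * ∫⁻ y, ∫⁻ v, f v ∂backStep κ δ q u W z y
            ∂K (Fin.cons (z' k') x') k' z' (newWeights κ δ q z a u z'))
          ∂(Measure.pi fun _ : Fin (N + 1) => gaussian u (δ / 2)) ∂volume ∂ancestors W k k' := by
        refine Finset.sum_congr rfl fun k _ => ?_
        rw [hK.lintegral_reference hδ hpos hcont hρ hρ_top k z hW h1 hf, uniformIndex,
          lintegral_discrete]
    _ = ∑ k', ENNReal.ofReal (1 / ((N : ℝ) + 1)) * ∫⁻ a, ∫⁻ u, ∫⁻ z', V k' a u z'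
          ∂(Measure.pi fun _ : Fin (N + 1) => gaussian u (δ / 2)) ∂volume
          ∂(Measure.pi fun _ : Fin (N + 1) => discrete W) := by
        simp only [Finset.mul_sum]
        rw [Finset.sum_comm]
        refine Finset.sum_congr rfl fun k' _ => ?_
        simp only [mul_left_comm (ENNReal.ofReal (W _))]
        rw [← Finset.mul_sum, sum_lintegral_ancestors (fun i => (hW i).le) h1 k']
    _ = ∑ k', ENNReal.ofReal (1 / ((N : ℝ) + 1)) * ∫⁻ a, ∫⁻ u, ∫⁻ z', G k' a u z' * Ψ u (z' k')
          ∂(Measure.pi fun _ : Fin (N + 1) => gaussian u (δ / 2)) ∂volume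
          ∂(Measure.pi fun _ : Fin (N + 1) => discrete W) := by
        -- Uniformity of `k'` makes its probability a common factor, so the sum over `k'` can be
        -- moved inside, where the hypothesis applies pointwise.
        rw [← Finset.mul_sum, ← Finset.mul_sum, sum_lintegral_lintegral_pi _ (half_pos hδ) hVm,
          sum_lintegral_lintegral_pi _ (half_pos hδ) hVm']
        simp only [hIH]
    _ = _ := by
        simp only [hterm]
        rw [sum_uniform_mul]
        exact sum_lintegral_backward hδ hpos hcont hρ z hW hf

/-! ### Path densities and the induction over the time points -/

/-- The unnormalised density of the path after its first state. -/
noncomputable def pathDensity {r : ℕ} (Q : Fin r → X D → X D → ℝ) (x : Fin (r + 1) → X D) :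
    ENNReal :=
  ∏ i : Fin r, ENNReal.ofReal (Q i (x i.castSucc) (x i.succ))

theorem measurable_pathDensity {r : ℕ} {Q : Fin r → X D → X D → ℝ}
    (hcont : ∀ i, Continuous (Function.uncurry (Q i))) : Measurable (pathDensity Q) :=
  Finset.measurable_prod _ fun i _ => ((hcont i).measurable.comp
    (f := fun x : Fin (r + 1) → X D => (x i.castSucc, x i.succ))
    ((measurable_pi_apply i.castSucc).prodMk (measurable_pi_apply i.succ))).ennreal_ofReal

theorem pathDensity_ne_top {r : ℕ} (Q : Fin r → X D → X D → ℝ) (x : Fin (r + 1) → X D) :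
    pathDensity Q x ≠ ⊤ :=
  ENNReal.prod_ne_top fun _ _ => ENNReal.ofReal_ne_top

theorem pathDensity_succ {r : ℕ} (Q : Fin (r + 1) → X D → X D → ℝ) :
    pathDensity Q = fun x : Fin (r + 2) → X D =>
      ENNReal.ofReal (Q 0 (x 0) (x 1)) * pathDensity (Fin.tail Q) (Fin.tail x) := by
  funext x
  rw [pathDensity, Fin.prod_univ_succ]
  rfl

theorem preserves_continueFrom (hN : 1 ≤ N) {κ : ℝ} :
    ∀ {r : ℕ} {δ : Fin r → ℝ} {Q : Fin r → X D → X D → ℝ}, (∀ i, 0 < δ i) →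
      (∀ i x y, 0 < Q i x y) → (∀ i, Continuous (Function.uncurry (Q i))) →
      Preserves (N := N) (continueFrom κ r δ Q) (pathDensity Q)
  | 0, δ, Q, _, _, _ => by
    refine preserves_of_normalized fun z W hW h1 f hf => ?_
    have hc : ∀ (k : Fin (N + 1)) (x' : Fin 0 → X D),
        (Fin.cons (z k) x' : Fin 1 → X D) = fun _ => z k := fun k x' => by
      funext i
      exact Fin.cases (Fin.cons_zero _ _) (fun j => j.elim0) i
    have hK : ∀ (x : Fin 1 → X D) (k : Fin (N + 1)), ∫⁻ y, f y ∂continueFrom κ 0 δ Q x k z W =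
        ∫⁻ l, f (fun _ => z l) ∂forcedMove W k := fun x k => by
      rw [continueFrom, Measure.lintegral_bind Measurable.of_discrete.aemeasurable hf.aemeasurable]
      simp only [lintegral_dirac' _ hf]
    -- No future remains: the density is an empty product and `X^0` is a point of volume one, which
    -- leaves the forced move.
    simp only [hK, hc, lintegral_const, pathDensity, Finset.univ_eq_empty, Finset.prod_empty,
      one_mul, volume_pi, Measure.pi_univ, mul_one]
    exact sum_lintegral_forcedMove hN hW h1 fun l => f fun _ => z l
  | r + 1, δ, Q, hδ, hpos, hcont => by
    rw [pathDensity_succ]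
    exact (preserves_continueFrom hN (fun i => hδ i.succ) (fun i => hpos i.succ)
      fun i => hcont i.succ).extend (isContinuation_continueFrom hN (fun i => hδ i.succ)
        (fun i => hpos i.succ) fun i => hcont i.succ) (hδ 0) (hpos 0) (hcont 0)
        (measurable_pathDensity fun i => hcont i.succ) (pathDensity_ne_top _)

end Algorithm

/-! ### The complete algorithm -/

section Step

attribute [local irreducible] gaussianDensity potential modifiedFactor drift

variable {D N r : ℕ}

/-- The algorithm is a recursive call from a fictitious earlier time point. -/
theorem lintegral_step (hN : 1 ≤ N) {κ : ℝ} {δ : Fin (r + 1) → ℝ} (hδ : ∀ t, 0 < δ t)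
    {Q₁ : X D → ℝ} {Q : Fin r → X D → X D → ℝ} (hpos₁ : ∀ x, 0 < Q₁ x)
    (hpos : ∀ i x y, 0 < Q i x y) (hcont₁ : Continuous Q₁)
    (hcont : ∀ i, Continuous (Function.uncurry (Q i))) (k : Fin (N + 1)) {W : Fin (N + 1) → ℝ}
    (hW : ∀ i, 0 < W i) (h1 : ∑ i, W i = 1) (x : Fin (r + 1) → X D)
    {f : (Fin (r + 1) → X D) → ENNReal} (hf : Measurable f) :
    ∫⁻ y, f y ∂step N κ δ Q₁ Q x =
      ∫⁻ y, f (Fin.tail y) ∂continueFrom κ (r + 1) δ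
        (Fin.cons (fun _ => Q₁) Q : Fin (r + 1) → X D → X D → ℝ) (Fin.cons 0 x) k
        (fun _ : Fin (N + 1) => 0) W := by
  have hK : IsContinuation (N := N) (continueFrom κ r (Fin.tail δ) Q) :=
    isContinuation_continueFrom hN (fun i => hδ i.succ) hpos hcont
  have hpos' : ∀ _x y : X D, 0 < Q₁ y := fun _ => hpos₁
  have hcont' : Continuous (Function.uncurry fun _ : X D => Q₁) := hcont₁.comp continuous_snd
  have hw : ∀ k' : Fin (N + 1), Measurable fun p : X D × (Fin (N + 1) → X D) =>
      continueFrom κ r (Fin.tail δ) Q x k' p.2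
        (normalize fun n => potential κ (δ 0) Q₁ p.1 (p.2 n)) := fun k' =>
    hK.measurable_newWeights (κ := κ) (δ := δ 0) (q := fun _ => Q₁) hpos' hcont' k'
      (fun _ => 0) measurable_const
      (z := fun _ _ => 0) measurable_const measurable_fst measurable_snd
  have hu : ∀ k' : Fin (N + 1), Measurable fun u : X D =>
      (particles (δ 0) u (x 0) k').bind fun z => continueFrom κ r (Fin.tail δ) Q x k' z
        (normalize fun n => potential κ (δ 0) Q₁ u (z n)) := fun k' =>
    measurable_bind_param (m := fun u => particles (δ 0) u (x 0) k')
      (measurable_particles (hδ 0) k' measurable_id measurable_const)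
      (fun _ => isProbabilityMeasure_particles (hδ 0) _ _ _) (hw k')
  have hft : Measurable fun y : Fin (r + 2) → X D => f (Fin.tail y) := hf.comp measurable_fin_tail
  -- The state selected at the fictitious time is dropped by `Fin.tail`, so backward sampling
  -- contributes only its total mass.
  have hback : ∀ u (y : Fin (r + 1) → X D), ∫⁻ v, f (Fin.tail v)
      ∂backStep κ (δ 0) (fun _ => Q₁) u W (fun _ : Fin (N + 1) => (0 : X D)) y = f y := fun u y => by
    have hm : ∀ i, 0 < W i * modifiedFactor κ (δ 0) Q₁ u (y 0) := fun i =>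
      mul_pos (hW i) (modifiedFactor_pos κ (hδ 0) hpos₁ u _)
    rw [lintegral_backStep u W _ y hft]
    simp only [Fin.tail_cons]
    rw [← Finset.sum_mul, ← ENNReal.ofReal_sum_of_nonneg fun i _ => (normalize_pos hm i).le,
      sum_normalize hm, ENNReal.ofReal_one, one_mul]
  rw [continueFrom_succ, Fin.cons_zero, Fin.tail_cons,
    hK.lintegral_extend (hδ 0) hpos' hcont' _ k _ W hft, step,
    Measure.lintegral_bind Measurable.of_discrete.aemeasurable hf.aemeasurable]
  refine lintegral_congr fun k' => ?_
  have := isProbabilityMeasure_ancestors (fun i => (hW i).le) h1 k k'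
  have hnw : ∀ a u z', newWeights κ (δ 0) (fun _ => Q₁) (fun _ : Fin (N + 1) => (0 : X D)) a u z' =
      normalize fun n => potential κ (δ 0) Q₁ u (z' n) := fun _ _ _ => rfl
  simp only [hback, hnw, Fin.tail_cons]
  have hx1 : (Fin.cons 0 x : Fin (r + 2) → X D) 1 = x 0 := rfl
  rw [hx1]
  -- The new weights do not see the ancestors, since the factor `Q₁` ignores the earlier state.
  have hconst : ∀ c, ∫⁻ _, c ∂ancestors W k k' = c := fun c => by
    rw [lintegral_const, measure_univ, mul_one]
  refine Eq.trans ?_ (hconst _).symm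
  rw [Measure.lintegral_bind (hu k').aemeasurable hf.aemeasurable]
  refine lintegral_congr fun u => ?_
  have hwu : Measurable fun z => continueFrom κ r (Fin.tail δ) Q x k' z
      (normalize fun n => potential κ (δ 0) Q₁ u (z n)) :=
    hK.measurable_newWeights (κ := κ) (δ := δ 0) (q := fun _ => Q₁) hpos' hcont' k'
      (fun _ => 0) measurable_const
      (z := fun _ _ => 0) measurable_const measurable_const measurable_id
  rw [Measure.lintegral_bind hwu.aemeasurable hf.aemeasurable]

theorem measurable_unnormDensity {Q₁ : X D → ℝ} {Q : Fin r → X D → X D → ℝ}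
    (hcont₁ : Continuous Q₁) (hcont : ∀ i, Continuous (Function.uncurry (Q i))) :
    Measurable (unnormDensity Q₁ Q) :=
  (hcont₁.measurable.comp (measurable_pi_apply 0)).mul
    (Finset.measurable_prod _ fun i _ => (hcont i).measurable.comp
      (f := fun x : Fin (r + 1) → X D => (x i.castSucc, x i.succ))
      ((measurable_pi_apply i.castSucc).prodMk (measurable_pi_apply i.succ)))

theorem pathDensity_cons {Q₁ : X D → ℝ} {Q : Fin r → X D → X D → ℝ} (hpos₁ : ∀ x, 0 < Q₁ x)
    (hpos : ∀ i x y, 0 < Q i x y) (x₀ : X D) (x : Fin (r + 1) → X D) :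
    pathDensity (Fin.cons (fun _ => Q₁) Q : Fin (r + 1) → X D → X D → ℝ) (Fin.cons x₀ x) =
      ENNReal.ofReal (unnormDensity Q₁ Q x) := by
  have hx1 : (Fin.cons x₀ x : Fin (r + 2) → X D) 1 = x 0 := rfl
  simp only [pathDensity_succ, Fin.cons_zero, hx1, Fin.tail_cons]
  rw [unnormDensity, ENNReal.ofReal_mul (hpos₁ _).le,
    ENNReal.ofReal_prod_of_nonneg fun i _ => (hpos i _ _).le]
  rfl

theorem uniform_pos (N : ℕ) (i : Fin (N + 1)) :
    0 < (fun _ : Fin (N + 1) => 1 / ((N : ℝ) + 1)) i := by positivity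

theorem sum_uniform (N : ℕ) : ∑ _i : Fin (N + 1), 1 / ((N : ℝ) + 1) = 1 := by
  have : (N : ℝ) + 1 ≠ 0 := by positivity
  simp [this]

/-- Transfers measurability and total mass from the recursion. The index `0`, the state `0` and the
uniform weights at the fictitious time are arbitrary choices. -/
theorem step_eq_map (hN : 1 ≤ N) {κ : ℝ} {δ : Fin (r + 1) → ℝ} (hδ : ∀ t, 0 < δ t)
    {Q₁ : X D → ℝ} {Q : Fin r → X D → X D → ℝ} (hpos₁ : ∀ x, 0 < Q₁ x)
    (hpos : ∀ i x y, 0 < Q i x y) (hcont₁ : Continuous Q₁)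
    (hcont : ∀ i, Continuous (Function.uncurry (Q i))) (x : Fin (r + 1) → X D) :
    step N κ δ Q₁ Q x = (continueFrom κ (r + 1) δ
        (Fin.cons (fun _ => Q₁) Q : Fin (r + 1) → X D → X D → ℝ) (Fin.cons 0 x) 0
        (fun _ : Fin (N + 1) => 0) fun _ => 1 / ((N : ℝ) + 1)).map Fin.tail := by
  refine Measure.ext_of_lintegral _ fun f hf => ?_
  rw [lintegral_map hf measurable_fin_tail, lintegral_step hN hδ hpos₁ hpos hcont₁ hcont 0
    (uniform_pos N) (sum_uniform N) x hf]

theorem isContinuation_cons (hN : 1 ≤ N) {κ : ℝ} {δ : Fin (r + 1) → ℝ} (hδ : ∀ t, 0 < δ t)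
    {Q₁ : X D → ℝ} {Q : Fin r → X D → X D → ℝ} (hpos₁ : ∀ x, 0 < Q₁ x)
    (hpos : ∀ i x y, 0 < Q i x y) (hcont₁ : Continuous Q₁)
    (hcont : ∀ i, Continuous (Function.uncurry (Q i))) :
    IsContinuation (N := N) (continueFrom κ (r + 1) δ
        (Fin.cons (fun _ => Q₁) Q : Fin (r + 1) → X D → X D → ℝ)) ∧
      Preserves (N := N) (continueFrom κ (r + 1) δ
        (Fin.cons (fun _ => Q₁) Q : Fin (r + 1) → X D → X D → ℝ))
        (pathDensity (Fin.cons (fun _ => Q₁) Q : Fin (r + 1) → X D → X D → ℝ)) := by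
  have hp : ∀ i x y, 0 < (Fin.cons (fun _ => Q₁) Q : Fin (r + 1) → X D → X D → ℝ) i x y :=
    Fin.cases (fun _ => hpos₁) hpos
  have hc : ∀ i, Continuous (Function.uncurry
      ((Fin.cons (fun _ => Q₁) Q : Fin (r + 1) → X D → X D → ℝ) i)) :=
    Fin.cases (hcont₁.comp continuous_snd) hcont
  exact ⟨isContinuation_continueFrom hN hδ hp hc, preserves_continueFrom hN hδ hp hc⟩

theorem measurable_step (hN : 1 ≤ N) {κ : ℝ} {δ : Fin (r + 1) → ℝ} (hδ : ∀ t, 0 < δ t)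
    {Q₁ : X D → ℝ} {Q : Fin r → X D → X D → ℝ} (hpos₁ : ∀ x, 0 < Q₁ x)
    (hpos : ∀ i x y, 0 < Q i x y) (hcont₁ : Continuous Q₁)
    (hcont : ∀ i, Continuous (Function.uncurry (Q i))) : Measurable (step N κ δ Q₁ Q) := by
  rw [funext (step_eq_map (κ := κ) hN hδ hpos₁ hpos hcont₁ hcont)]
  have h₀ : Measurable fun x : Fin (r + 1) → X D => (Fin.cons 0 x : Fin (r + 2) → X D) :=
    measurable_fin_cons.comp (f := fun x => ((0 : X D), x)) measurable_prodMk_left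
  have h : Measurable fun x : Fin (r + 1) → X D => ((Fin.cons 0 x : Fin (r + 2) → X D),
      (fun _ : Fin (N + 1) => (0 : X D)), fun _ : Fin (N + 1) => 1 / ((N : ℝ) + 1)) :=
    h₀.prodMk measurable_const
  have hK := ((isContinuation_cons (κ := κ) hN hδ hpos₁ hpos hcont₁ hcont).1.measurable 0).comp h
  exact (Measure.measurable_map _ measurable_fin_tail).comp hK

theorem isProbabilityMeasure_step (hN : 1 ≤ N) {κ : ℝ} {δ : Fin (r + 1) → ℝ} (hδ : ∀ t, 0 < δ t)
    {Q₁ : X D → ℝ} {Q : Fin r → X D → X D → ℝ} (hpos₁ : ∀ x, 0 < Q₁ x)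
    (hpos : ∀ i x y, 0 < Q i x y) (hcont₁ : Continuous Q₁)
    (hcont : ∀ i, Continuous (Function.uncurry (Q i))) (x : Fin (r + 1) → X D) :
    IsProbabilityMeasure (step N κ δ Q₁ Q x) := by
  have := (isContinuation_cons hN hδ hpos₁ hpos hcont₁ hcont (κ := κ)).1.isProbabilityMeasure
    (Fin.cons 0 x) 0 (fun _ => 0) _ (uniform_pos N) (sum_uniform N)
  rw [step_eq_map hN hδ hpos₁ hpos hcont₁ hcont]
  exact Measure.isProbabilityMeasure_map measurable_fin_tail.aemeasurable

theorem lintegral_unnormDensity_step (hN : 1 ≤ N) {κ : ℝ} {δ : Fin (r + 1) → ℝ}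
    (hδ : ∀ t, 0 < δ t) {Q₁ : X D → ℝ} {Q : Fin r → X D → X D → ℝ} (hpos₁ : ∀ x, 0 < Q₁ x)
    (hpos : ∀ i x y, 0 < Q i x y) (hcont₁ : Continuous Q₁)
    (hcont : ∀ i, Continuous (Function.uncurry (Q i))) {f : (Fin (r + 1) → X D) → ENNReal}
    (hf : Measurable f) :
    ∫⁻ x, ENNReal.ofReal (unnormDensity Q₁ Q x) * ∫⁻ y, f y ∂step N κ δ Q₁ Q x =
      ∫⁻ x, ENNReal.ofReal (unnormDensity Q₁ Q x) * f x := by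
  -- All fictitious particles coincide, so the `N + 1` summands are equal and their uniform weights
  -- add up to one.
  have h := (isContinuation_cons hN hδ hpos₁ hpos hcont₁ hcont (κ := κ)).2 (fun _ => 0) _
    (uniform_pos N) (fun y => f (Fin.tail y)) (hf.comp measurable_fin_tail)
  simpa only [normalize_eq_self (sum_uniform N), pathDensity_cons hpos₁ hpos,
    ← lintegral_step hN hδ hpos₁ hpos hcont₁ hcont _ (uniform_pos N) (sum_uniform N) _ hf,
    Fin.tail_cons, sum_uniform_mul] using h

/-- The algorithm leaves the joint smoothing distribution invariant. -/
theorem smoothing_bind_step (hN : 1 ≤ N) {κ : ℝ} {δ : Fin (r + 1) → ℝ}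
    (hδ : ∀ t, 0 < δ t) {Q₁ : X D → ℝ} {Q : Fin r → X D → X D → ℝ} (hpos₁ : ∀ x, 0 < Q₁ x)
    (hpos : ∀ i x y, 0 < Q i x y) (hcont₁ : Continuous Q₁)
    (hcont : ∀ i, Continuous (Function.uncurry (Q i))) :
    (smoothing Q₁ Q).bind (step N κ δ Q₁ Q) = smoothing Q₁ Q := by
  have hm := measurable_step (κ := κ) hN hδ hpos₁ hpos hcont₁ hcont
  have hd : Measurable fun x => ENNReal.ofReal (density Q₁ Q x) :=
    ((measurable_unnormDensity hcont₁ hcont).div_const _).ennreal_ofReal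
  -- The normalising constant becomes the same factor on both sides of the invariance identity, so
  -- its value plays no role.
  have hsm : ∀ g : (Fin (r + 1) → X D) → ENNReal, Measurable g → ∫⁻ x, g x ∂smoothing Q₁ Q =
      ENNReal.ofReal (∫ y, unnormDensity Q₁ Q y)⁻¹ *
        ∫⁻ x, ENNReal.ofReal (unnormDensity Q₁ Q x) * g x := fun g hg => by
    rw [smoothing, lintegral_withDensity_eq_lintegral_mul _ hd hg,
      ← lintegral_const_mul' _ _ ENNReal.ofReal_ne_top]
    refine lintegral_congr fun x => ?_
    rw [Pi.mul_apply, density, div_eq_mul_inv,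
      ENNReal.ofReal_mul (unnormDensity_pos hpos₁ hpos x).le]
    ring
  refine Measure.ext_of_lintegral _ fun f hf => ?_
  rw [Measure.lintegral_bind hm.aemeasurable hf.aemeasurable,
    hsm (fun x => ∫⁻ y, f y ∂step N κ δ Q₁ Q x) ((Measure.measurable_lintegral hf).comp hm), hsm f hf,
    lintegral_unnormDensity_step hN hδ hpos₁ hpos hcont₁ hcont hf]

end Step
end ParticleAMALA

/-! ### The Markov kernel and its invariance -/

theorem mainTheorem7 (D S N : ℕ) (hN : 1 ≤ N)
    (κ : ℝ) (hκ : κ = 0 ∨ κ = 1)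
    (δ : Fin (S + 1) → ℝ) (hδ : ∀ t, 0 < δ t)
    (Q₁ : EuclideanSpace ℝ (Fin D) → ℝ)
    (Q : Fin S → EuclideanSpace ℝ (Fin D) → EuclideanSpace ℝ (Fin D) → ℝ)
    (hQ₁pos : ∀ x, 0 < Q₁ x) (hQpos : ∀ i x y, 0 < Q i x y)
    (hQ₁diff : Differentiable ℝ Q₁)
    (hQdiff : ∀ i, Differentiable ℝ
      (fun p : EuclideanSpace ℝ (Fin D) × EuclideanSpace ℝ (Fin D) => Q i p.1 p.2))
    (hint : MeasureTheory.Integrable (ParticleAMALA.unnormDensity Q₁ Q)) :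
    ∃ P : ProbabilityTheory.Kernel (Fin (S + 1) → EuclideanSpace ℝ (Fin D))
        (Fin (S + 1) → EuclideanSpace ℝ (Fin D)),
      (∀ x, P x = ParticleAMALA.step N κ δ Q₁ Q x) ∧
      ProbabilityTheory.IsMarkovKernel P ∧
      P.Invariant (ParticleAMALA.smoothing Q₁ Q) := by
  have hcont₁ := hQ₁diff.continuous
  have hcont : ∀ i, Continuous (Function.uncurry (Q i)) := fun i => (hQdiff i).continuous
  exact ⟨⟨ParticleAMALA.step N κ δ Q₁ Q,
      ParticleAMALA.measurable_step hN hδ hQ₁pos hQpos hcont₁ hcont⟩, fun _ => rfl,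
    ⟨ParticleAMALA.isProbabilityMeasure_step hN hδ hQ₁pos hQpos hcont₁ hcont⟩,
    ParticleAMALA.smoothing_bind_step hN hδ hQ₁pos hQpos hcont₁ hcont⟩
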